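/- Let $r\ge 2$ and $0\le n_{cp}<r-1$. On a uniform mesh with cells $I_i=[x_{i-1/2},x_{i+1/2}]$ of width $h$ and centres $x_i$, given cell averages $(\bar u_i)$, the $(2r-1)$th-order MOP-WENO-ACM reconstruction is defined as follows. (a) For $s=0,\dots,r-1$ let $p_s$ be the polynomial of degree $<r$ having the averages $\bar u_i$ on the cells of $S_s=\{I_{j+s-r+1},\dots,I_{j+s}\}$, and put $$u^s_{j+1/2}=p_s(x_{j+1/2}),\qquad \beta_s=\sum_{l=1}^{r-1}h^{2l-1}\int_{I_j}\big(p_s^{(l)}(x)\big)^2\,dx .$$ The ideal weights $d_0,\dots,d_{r-1}$ are the numbers for which, for all data, $\sum_s d_su^s_{j+1/2}$ is the value at $x_{j+1/2}$ of the polynomial of degree $<2r-1$ having the averages $\bar u_i$ on $I_{j-r+1},\dots,I_{j+r-1}$. The WENO-JS weights are $\omega^{JS}_s=\alpha_s/\sum_l\alpha_l$ with $\alpha_s=d_s/(\epsilon+\beta_s)^2$. (b) Let $B>0$, $k\in\mathbb N^+$ and, for each $s$, $\mathrm{CFS}_s\in(0,d_s)$, $\overline{\mathrm{CFS}}_s=1-\frac{1-d_s}{d_s}\mathrm{CFS}_s\in(d_s,1)$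 and $0<\delta_s<\min\{\mathrm{CFS}_s,\ d_s-\mathrm{CFS}_s,\ (1-d_s)(1-\mathrm{CFS}_s/d_s),\ \frac{1-d_s}{d_s}\mathrm{CFS}_s\}$. Let $\mathrm{sgm}(x,\delta,B,k)=x/|x|$ if $|x|\ge\delta$ and $\mathrm{sgm}(x,\delta,B,k)=x/\big((B(\delta^2-x^2))^{k+3}+|x|\big)$ if $|x|<\delta$, and let $$g^{ACM}_s(\omega)=\begin{cases}\frac{d_s}{2}\,\mathrm{sgm}(\omega-\mathrm{CFS}_s,\delta_s,B,k)+\frac{d_s}{2},&\omega\le d_s,\\[2pt] \frac{1-d_s}{2}\,\mathrm{sgm}(\omega-\overline{\mathrm{CFS}}_s,\delta_s,B,k)+\frac{1+d_s}{2},&\omega>d_s.\end{cases}$$ The order-preserving mapping is $g^{MOP\text{-}ACM}(\omega)=g^{ACM}_{k^*(\omega)}(\omega)$, where $k^*(\omega)$ is the smallest index $i$ minimizing $|\omega-d_i|$. Put $$\omega_s=\frac{g^{MOP\text{-}ACM}(\omega^{JS}_s)}{\sum_l g^{MOP\text{-}ACM}(\omega^{JS}_l)},\qquad u^-_{j+1/2}=\sum_{s}\omega_su^s_{j+1/2},$$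 and define $u^+_{j+1/2}$ by mirror symmetry with respect to $x_{j+1/2}$. (c) For a flux function $f$ and a constant $\alpha\in\mathbb R$ (in particular $\alpha=\max|f'|$) let $\hat f_{j+1/2}=\frac12\big[f(u^-_{j+1/2})+f(u^+_{j+1/2})-\alpha(u^+_{j+1/2}-u^-_{j+1/2})\big]$; the semi-discrete scheme for $\partial_tu+\partial_xf(u)=0$ has the spatial operator $\mathcal L_j=-\frac1h(\hat f_{j+1/2}-\hat f_{j-1/2})$. **Claim.** Let $u$ be a function that is smooth ($C^\infty$) at $x_0$ with $u^{(l)}(x_0)=0$ for $1\le l\le n_{cp}$ and $u^{(n_{cp}+1)}(x_0)\ne0$ (for $n_{cp}\ge 1$, $x_0$ is a critical point of order $n_{cp}$), and let $f$ be smooth at $u(x_0)$. Then the scheme attains the optimal order $2r-1$ at and near $x_0$: there are $C,h_0,\eta>0$, independent of the regularization parameter $\epsilon$, such that for every $\epsilon\ge0$, every uniform mesh of width $0<h<h_0$ and every cell with $|x_j-x_0|<\eta$, the reconstructions and the operator formed from the exact cell averages $\bar u_i=\frac1h\int_{I_i}u$ satisfy $$|u^{\pm}_{j+1/2}-u(x_{j+1/2})|\le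 Ch^{2r-1},\qquad \Big|\mathcal L_j+\frac1h\int_{I_j}\partial_xf(u)\,dx\Big|\le Ch^{2r-1}.$$ -/

import Mathlib

open scoped ContDiff Polynomial

noncomputable section

namespace WENO

/-! ### Local reconstruction polynomials

All polynomials are written in the scaled variable `ξ = (x - x_j) / Δx`, so that the cell `I_{j+i}`
becomes `[i - 1/2, i + 1/2]`; `v i` is the cell average on `I_{j+i}`. -/

/-- The polynomial of degree less than `m` whose averages on the `m` consecutive cells
`a, a + 1, …, a + m - 1` are `v a, …, v (a + m - 1)`: the derivative of the polynomial that
interpolates the primitive of the data at the `m + 1` cell boundaries. -/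
def reconPoly (a : ℤ) (m : ℕ) (v : ℤ → ℝ) : ℝ[X] :=
  Polynomial.derivative
    (Lagrange.interpolate (Finset.range (m + 1))
      (fun i : ℕ => (a : ℝ) + (i : ℝ) - 1 / 2)
      (fun i : ℕ => ∑ k ∈ Finset.range i, v (a + (k : ℤ))))

/-- The polynomial on the substencil `S_s = {I_{j+s-r+1}, …, I_{j+s}}`. -/
def subPoly {r : ℕ} (s : Fin r) (v : ℤ → ℝ) : ℝ[X] :=
  reconPoly ((s : ℤ) - (r : ℤ) + 1) r v

/-- The `r`th-order approximation `u^s_{j+1/2}` of the value at the right boundary of `I_j`. -/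
def subValue {r : ℕ} (s : Fin r) (v : ℤ → ℝ) : ℝ :=
  (subPoly s v).eval (1 / 2)

/-- The linear `(2r-1)`th-order upstream central approximation of the value at the right boundary
of `I_j` from the global stencil `S^{2r-1} = {I_{j-r+1}, …, I_{j+r-1}}`. -/
def globalValue (r : ℕ) (v : ℤ → ℝ) : ℝ :=
  (reconPoly (1 - (r : ℤ)) (2 * r - 1) v).eval (1 / 2)

/-- `d` are the ideal (optimal) weights: the combination of the substencil approximations with
these weights is the linear upstream central scheme on the global stencil. -/
def IsIdealWeights {r : ℕ} (d : Fin r → ℝ) : Prop :=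
  ∀ v : ℤ → ℝ, ∑ s, d s * subValue s v = globalValue r v

/-- The Jiang–Shu smoothness indicator
`β_s = ∑_{l=1}^{r-1} Δx^{2l-1} ∫_{I_j} (d^l p_s / dx^l)^2 dx`.
In the scaled variable all powers of `Δx` cancel. -/
def smoothness {r : ℕ} (s : Fin r) (v : ℤ → ℝ) : ℝ :=
  ∑ l ∈ Finset.Icc 1 (r - 1),
    ∫ ξ in (-(1 / 2) : ℝ)..(1 / 2), ((Polynomial.derivative^[l] (subPoly s v)).eval ξ) ^ 2

/-- Unnormalised WENO-JS weights `α_s = d_s / (ε + β_s)^2`. -/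
def alphaJS {r : ℕ} (d : Fin r → ℝ) (ε : ℝ) (v : ℤ → ℝ) (s : Fin r) : ℝ :=
  d s / (ε + smoothness s v) ^ 2

/-- The nonlinear weights of WENO-JS. -/
def omegaJS {r : ℕ} (d : Fin r → ℝ) (ε : ℝ) (v : ℤ → ℝ) (s : Fin r) : ℝ :=
  alphaJS d ε v s / ∑ l, alphaJS d ε v l

/-! ### The mapping functions -/

/-- The regularised sign function `sgm(x, δ, B, k)`. -/
def sgm (x δ B : ℝ) (k : ℕ) : ℝ :=
  if δ ≤ |x| then x / |x| else x / ((B * (δ ^ 2 - x ^ 2)) ^ (k + 3) + |x|)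

/-- `1 - (1 - d) / d * CFS`. -/
def CFSbar (d CFS : ℝ) : ℝ := 1 - (1 - d) / d * CFS

/-- The WENO-ACM mapping function with substencil parameters `d`, `CFS`, `δ`. -/
def gACM (B : ℝ) (k : ℕ) (d CFS δ w : ℝ) : ℝ :=
  if w ≤ d then d / 2 * sgm (w - CFS) δ B k + d / 2
  else (1 - d) / 2 * sgm (w - CFSbar d CFS) δ B k + (1 + d) / 2

/-- The admissible parameters of the WENO-ACM mapping functions. -/
structure ACMAdmissible {r : ℕ} (B : ℝ) (k : ℕ) (d CFS δ : Fin r → ℝ) : Prop where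
  B_pos : 0 < B
  k_pos : 1 ≤ k
  CFS_mem : ∀ s, CFS s ∈ Set.Ioo 0 (d s)
  CFSbar_mem : ∀ s, CFSbar (d s) (CFS s) ∈ Set.Ioo (d s) 1
  delta_pos : ∀ s, 0 < δ s
  delta_lt : ∀ s, δ s < min (min (CFS s) (d s - CFS s))
    (min ((1 - d s) * (1 - CFS s / d s)) ((1 - d s) / d s * CFS s))

/-- The indices at which `|w - d_i|` is smallest. -/
def nearestIndices {r : ℕ} (d : Fin r → ℝ) (w : ℝ) : Finset (Fin r) :=
  {i | ∀ j, |w - d i| ≤ |w - d j|}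

theorem nearestIndices_nonempty {r : ℕ} [NeZero r] (d : Fin r → ℝ) (w : ℝ) :
    (nearestIndices d w).Nonempty := by
  obtain ⟨i, _, hi⟩ := Finset.exists_min_image Finset.univ (fun i : Fin r => |w - d i|)
    Finset.univ_nonempty
  exact ⟨i, by simpa [nearestIndices] using hi⟩

/-- `minDist(x_0, …, x_{r-1}; d_0, …, d_{r-1}; w) = x_{k^*}`, where `k^*` is the smallest index at
which `|w - d_i|` attains its minimum. -/
def minDist {r : ℕ} [NeZero r] (x d : Fin r → ℝ) (w : ℝ) : ℝ :=
  x ((nearestIndices d w).min' (nearestIndices_nonempty d w))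

/-- The order-preserving mapping `g^{MOP-ACM}`: the ACM mapping in which each parameter that
depends on the substencil is replaced by its `minDist` value. The result is the same function for
every substencil. -/
def gMOPACM {r : ℕ} [NeZero r] (B : ℝ) (k : ℕ) (d CFS δ : Fin r → ℝ) (w : ℝ) : ℝ :=
  gACM B k (minDist d d w) (minDist CFS d w) (minDist δ d w) w

/-- `α_s^{MOP-ACM} = g^{MOP-ACM}(w_s^{JS})`. -/
def alphaMOPACM {r : ℕ} [NeZero r] (B : ℝ) (k : ℕ) (d CFS δ : Fin r → ℝ) (ε : ℝ) (v : ℤ → ℝ)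
    (s : Fin r) : ℝ :=
  gMOPACM B k d CFS δ (omegaJS d ε v s)

/-- The nonlinear weights of MOP-WENO-ACM. -/
def omegaMOPACM {r : ℕ} [NeZero r] (B : ℝ) (k : ℕ) (d CFS δ : Fin r → ℝ) (ε : ℝ) (v : ℤ → ℝ)
    (s : Fin r) : ℝ :=
  alphaMOPACM B k d CFS δ ε v s / ∑ l, alphaMOPACM B k d CFS δ ε v l

/-- The left-biased MOP-WENO-ACM reconstruction at the right boundary of the central cell. -/
def reconMOPACM {r : ℕ} [NeZero r] (B : ℝ) (k : ℕ) (d CFS δ : Fin r → ℝ) (ε : ℝ)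
    (v : ℤ → ℝ) : ℝ :=
  ∑ s, omegaMOPACM B k d CFS δ ε v s * subValue s v

/-! ### The finite volume scheme, for a reconstruction procedure `R` -/

/-- `u^-_{j+1/2}` from the cell averages `U`. -/
def uMinus (R : (ℤ → ℝ) → ℝ) (U : ℤ → ℝ) (j : ℤ) : ℝ := R fun i => U (j + i)

/-- `u^+_{j+1/2}` from the cell averages `U`: the mirror image of `u^-_{j+1/2}` with respect to
`x_{j+1/2}`. -/
def uPlus (R : (ℤ → ℝ) → ℝ) (U : ℤ → ℝ) (j : ℤ) : ℝ := R fun i => U (j + 1 - i)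

/-- The global Lax–Friedrichs flux. -/
def laxFriedrichs (f : ℝ → ℝ) (α a b : ℝ) : ℝ := (f a + f b - α * (b - a)) / 2

/-- The numerical flux at `x_{j+1/2}`. -/
def numFlux (R : (ℤ → ℝ) → ℝ) (f : ℝ → ℝ) (α : ℝ) (U : ℤ → ℝ) (j : ℤ) : ℝ :=
  laxFriedrichs f α (uMinus R U j) (uPlus R U j)

/-- The semi-discrete spatial operator `-(f̂_{j+1/2} - f̂_{j-1/2}) / Δx`. -/
def spatialOp (R : (ℤ → ℝ) → ℝ) (f : ℝ → ℝ) (α h : ℝ) (U : ℤ → ℝ) (j : ℤ) : ℝ :=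
  -(1 / h) * (numFlux R f α U j - numFlux R f α U (j - 1))

/-- The centre `x_j` of the `j`th cell. -/
def center (xl h : ℝ) (j : ℤ) : ℝ := xl + ((j : ℝ) - 1 / 2) * h

/-- The average of `φ` on the `j`th cell `[x_j - h/2, x_j + h/2]`. -/
def cellAvg (φ : ℝ → ℝ) (xl h : ℝ) (j : ℤ) : ℝ :=
  (1 / h) * ∫ y in (center xl h j - h / 2)..(center xl h j + h / 2), φ y

/-- `u` has order `n` at `x₀` in the sense of critical points: the derivatives of orders `1, …, n`
vanish and the one of order `n + 1` does not (`n = 0`: not a critical point). -/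
def HasCriticalOrder (u : ℝ → ℝ) (x₀ : ℝ) (n : ℕ) : Prop :=
  (∀ l ∈ Finset.Icc 1 n, iteratedDeriv l u x₀ = 0) ∧ iteratedDeriv (n + 1) u x₀ ≠ 0

end WENO

end

noncomputable section

namespace WENO

open Finset intervalIntegral Topology

/-! The ACM mapping is flat at the ideal weights: `g` equals `d_s` on a whole interval around `d_s`.
So once the JS weights lie within a fixed distance `ρ` of the ideal ones, the mapped weights are
exactly ideal, and the nonlinear reconstruction coincides with the linear central one
(`exists_reconMOPACM_eq_globalValue`). No rate of convergence of the JS weights is needed.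

Closeness of the JS weights only requires the ratios of the `β_s` to be close to 1. Adding `ε ≥ 0`
brings the ratios closer still, whence the uniformity in `ε`. In the scaled variable every `p_s` is
one common Taylor polynomial plus `O(h^r)`. A nonzero derivative of order `n ≤ r - 1` makes the
indicator of that polynomial at least `c h^(2n)`, so the perturbation is relatively small
(`exists_smoothness_rescale_ratio`).

The linear scheme has error `O(h^(2r-1))`. Dividing the flux difference by `h` would cost one order,
but the linear error is Lipschitz in the position, because its increment is the linear error of `u -
u(· - y)` (`exists_abs_linearError_le`). The extra factor `h` survives the Lax–Friedrichs flux when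
`f` is `C²` (`exists_abs_increment_sub_le`). -/

/-! ### Reconstruction polynomials: linearity and polynomial exactness. -/

/-- The polynomials `reconPoly a m` of the unit data supported on one cell. -/
def reconBasis (a : ℤ) (m k : ℕ) : ℝ[X] :=
  Polynomial.derivative
    (Lagrange.interpolate (range (m + 1)) (fun i : ℕ => (a : ℝ) + (i : ℝ) - 1 / 2)
      (fun i : ℕ => if k < i then 1 else 0))

theorem reconPoly_eq_sum (a : ℤ) (m : ℕ) (v : ℤ → ℝ) :
    reconPoly a m v = ∑ k ∈ range m, v (a + (k : ℤ)) • reconBasis a m k := by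
  unfold reconPoly reconBasis
  simp_rw [← map_smul, ← map_sum]
  congr 1
  refine Lagrange.interpolate_eq_of_values_eq_on _ _ fun i hi => ?_
  rw [Finset.sum_apply]
  simp only [Pi.smul_apply, smul_eq_mul, mul_ite, mul_one, mul_zero]
  rw [← sum_filter]
  refine sum_congr ?_ fun _ _ => rfl
  ext k
  simp only [mem_range, mem_filter] at hi ⊢
  omega

theorem reconPoly_sub (a : ℤ) (m : ℕ) (v w : ℤ → ℝ) :
    reconPoly a m (v - w) = reconPoly a m v - reconPoly a m w := by
  simp only [reconPoly_eq_sum, Pi.sub_apply, sub_smul, sum_sub_distrib]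

theorem reconPoly_congr {a : ℤ} {m : ℕ} {v w : ℤ → ℝ}
    (h : ∀ k < m, v (a + (k : ℤ)) = w (a + (k : ℤ))) : reconPoly a m v = reconPoly a m w := by
  rw [reconPoly_eq_sum, reconPoly_eq_sum]
  exact sum_congr rfl fun k hk => by rw [h k (mem_range.1 hk)]

/-- The averages of `φ` on the unit cells `[i - 1/2, i + 1/2]`. -/
def unitAvg (φ : ℝ → ℝ) (i : ℤ) : ℝ := ∫ ξ in ((i : ℝ) - 1 / 2)..((i : ℝ) + 1 / 2), φ ξ

theorem exists_antiderivative {p : ℝ[X]} {m : ℕ} (hm : 0 < m) (hp : p.degree < m) :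
    ∃ q : ℝ[X], q.derivative = p ∧ q.degree < (m + 1 : ℕ) := by
  refine ⟨∑ i ∈ range m, Polynomial.C (p.coeff i / (i + 1)) * Polynomial.X ^ (i + 1), ?_, ?_⟩
  · rw [Polynomial.derivative_sum]
    conv_rhs => rw [Polynomial.as_sum_range' p m
      (by
        by_cases h0 : p = 0
        · simpa [h0] using hm
        · exact (Polynomial.natDegree_lt_iff_degree_lt h0).2 hp)]
    refine sum_congr rfl fun i _ => ?_
    have : (i : ℝ) + 1 ≠ 0 := by positivity
    rw [Polynomial.derivative_C_mul_X_pow, ← Polynomial.C_mul_X_pow_eq_monomial]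
    simp [this]
  · refine lt_of_le_of_lt (Polynomial.degree_sum_le _ _) ?_
    rw [Finset.sup_lt_iff (by exact WithBot.bot_lt_coe _)]
    intro i hi
    refine lt_of_le_of_lt (Polynomial.degree_C_mul_X_pow_le _ _) ?_
    have := mem_range.1 hi
    exact_mod_cast Nat.succ_lt_succ this

/-- The partial sums of the averages are the values of a primitive at the `m + 1` cell boundaries,
up to a constant; a primitive of degree at most `m` is its own interpolant. -/
theorem reconPoly_unitAvg_eval {p : ℝ[X]} {m : ℕ} (hm : 0 < m) (hp : p.degree < m) (a : ℤ) :
    reconPoly a m (unitAvg fun ξ => p.eval ξ) = p := by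
  obtain ⟨q, rfl, hq⟩ := exists_antiderivative hm hp
  have hint : ∀ i : ℤ, unitAvg (fun ξ => q.derivative.eval ξ) i
      = q.eval ((i : ℝ) + 1 / 2) - q.eval ((i : ℝ) - 1 / 2) := fun i =>
    integral_eq_sub_of_hasDerivAt (fun x _ => q.hasDerivAt x)
      (q.derivative.continuous.intervalIntegrable _ _)
  have hinj : Set.InjOn (fun i : ℕ => (a : ℝ) + (i : ℝ) - 1 / 2) (range (m + 1) : Finset ℕ) := by
    intro i _ j _ hij
    have : (i : ℝ) = j := by simpa using hij
    exact_mod_cast this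
  have hsum : ∀ i : ℕ, ∑ k ∈ range i, unitAvg (fun ξ => q.derivative.eval ξ) (a + (k : ℤ))
      = q.eval ((a : ℝ) + (i : ℝ) - 1 / 2) - q.eval ((a : ℝ) - 1 / 2) := by
    intro i
    induction i with
    | zero => simp
    | succ i ih =>
      rw [sum_range_succ, ih, hint]
      push_cast
      rw [show (a : ℝ) + i + 1 / 2 = a + (i + 1) - 1 / 2 by ring]
      ring
  unfold reconPoly
  rw [← Lagrange.eq_interpolate_of_eval_eq
    (f := q - Polynomial.C (q.eval ((a : ℝ) - 1 / 2))) _ hinj]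
  · simp
  · rw [card_range]
    refine lt_of_le_of_lt (Polynomial.degree_sub_le _ _) (max_lt hq ?_)
    exact lt_of_le_of_lt Polynomial.degree_C_le (by exact_mod_cast Nat.succ_pos m)
  · intro i _
    rw [hsum]
    simp

theorem unitAvg_sub {φ ψ : ℝ → ℝ} (hφ : Continuous φ) (hψ : Continuous ψ) :
    unitAvg (φ - ψ) = unitAvg φ - unitAvg ψ := by
  funext i
  exact integral_sub (hφ.intervalIntegrable _ _) (hψ.intervalIntegrable _ _)

theorem abs_unitAvg_le {φ : ℝ → ℝ} {A : ℝ} {R : ℝ} (hφ : ∀ ξ ∈ Set.Icc (-R) R, |φ ξ| ≤ A)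
    {i : ℤ} (hi : |(i : ℝ)| + 1 / 2 ≤ R) : |unitAvg φ i| ≤ A := by
  have h := norm_integral_le_of_norm_le_const (f := φ) (C := A)
    (a := (i : ℝ) - 1 / 2) (b := (i : ℝ) + 1 / 2) ?_
  · simpa [unitAvg] using le_trans h (by norm_num : A * |(i : ℝ) + 1 / 2 - (i - 1 / 2)| ≤ A)
  · intro ξ hξ
    rw [Set.uIoc_of_le (by linarith)] at hξ
    have := abs_le.1 (le_sub_iff_add_le.2 hi)
    exact hφ ξ ⟨by linarith [hξ.1], by linarith [hξ.2]⟩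

/-! ### Taylor expansion and the error of the linear reconstruction. -/

/-- The Taylor polynomial of `φ` at `a` of degree less than `n`. -/
def taylorPoly (φ : ℝ → ℝ) (a : ℝ) (n : ℕ) : ℝ[X] :=
  ∑ k ∈ range n, Polynomial.C (iteratedDeriv k φ a / k.factorial) *
    (Polynomial.X - Polynomial.C a) ^ k

theorem degree_taylorPoly_lt (φ : ℝ → ℝ) (a : ℝ) (n : ℕ) : (taylorPoly φ a n).degree < n := by
  refine lt_of_le_of_lt (Polynomial.degree_sum_le _ _) ?_
  rw [Finset.sup_lt_iff (by exact WithBot.bot_lt_coe _)]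
  intro i hi
  refine lt_of_le_of_lt (Polynomial.degree_mul_le _ _) ?_
  rw [Polynomial.degree_pow, Polynomial.degree_X_sub_C, nsmul_one]
  refine lt_of_le_of_lt (add_le_add_left Polynomial.degree_C_le _) ?_
  rw [zero_add]
  exact_mod_cast mem_range.1 hi

theorem eval_iterate_derivative_taylorPoly (φ : ℝ → ℝ) (a : ℝ) {n l : ℕ} (hl : l < n) :
    (Polynomial.derivative^[l] (taylorPoly φ a n)).eval a = iteratedDeriv l φ a := by
  rw [taylorPoly, Polynomial.iterate_derivative_sum, Polynomial.eval_finsetSum,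
    sum_eq_single_of_mem l (mem_range.2 hl)]
  · rw [Polynomial.iterate_derivative_C_mul, Polynomial.iterate_derivative_X_sub_pow_self]
    have : (l.factorial : ℝ) ≠ 0 := by positivity
    simp
    field_simp
  · intro k _ hk
    rw [Polynomial.iterate_derivative_C_mul, Polynomial.iterate_derivative_X_sub_pow]
    rcases lt_or_gt_of_ne hk with h | h
    · simp [Nat.descFactorial_of_lt h]
    · simp [Nat.sub_ne_zero_of_lt h]

/-- Expanding at the left endpoint lets a one-sided remainder estimate cover the whole interval; the
factorial is discarded. -/
theorem abs_sub_taylorPoly_le {φ : ℝ → ℝ} {n : ℕ} (hn : 0 < n) (hφ : ContDiff ℝ n φ) {R M : ℝ}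
    (hR : 0 < R) (hM : ∀ ξ ∈ Set.Icc (-R) R, |iteratedDeriv n φ ξ| ≤ M) {ξ : ℝ}
    (hξ : ξ ∈ Set.Icc (-R) R) : |φ ξ - (taylorPoly φ (-R) n).eval ξ| ≤ M * (2 * R) ^ n := by
  obtain ⟨n, rfl⟩ := Nat.exists_eq_succ_of_ne_zero hn.ne'
  have hlt : -R < R := by linarith
  have heq : ∀ k ≤ n + 1, ∀ y ∈ Set.Icc (-R) R,
      iteratedDerivWithin k φ (Set.Icc (-R) R) y = iteratedDeriv k φ y := fun k hk y hy =>
    iteratedDerivWithin_eq_iteratedDeriv (uniqueDiffOn_Icc hlt)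
      (hφ.contDiffAt.of_le (by exact_mod_cast hk)) hy
  have h := taylor_mean_remainder_bound (f := φ) (C := M) hlt.le
    (by exact_mod_cast hφ.contDiffOn) hξ
    (fun y hy => by rw [heq _ le_rfl y hy]; exact hM y hy)
  have hT : taylorWithinEval φ n (Set.Icc (-R) R) (-R) ξ
      = (taylorPoly φ (-R) (n + 1)).eval ξ := by
    rw [taylor_within_apply, taylorPoly, Polynomial.eval_finsetSum]
    refine sum_congr rfl fun k hk => ?_
    rw [heq k (mem_range.1 hk).le _ ⟨le_rfl, hlt.le⟩]
    simp
    ring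
  rw [hT] at h
  have hM0 : 0 ≤ M := (abs_nonneg _).trans (hM ξ hξ)
  have h1 : 0 ≤ ξ - -R := by linarith [hξ.1]
  refine h.trans ((div_le_self (by positivity) (by exact_mod_cast Nat.one_le_iff_ne_zero.2 (Nat.factorial_ne_zero n))).trans ?_)
  have : ξ - -R ≤ 2 * R := by linarith [hξ.2]
  gcongr

/-- The reconstruction differs from the Taylor polynomial by the reconstruction of data that are
bounded by the derivative of order `m`. -/
theorem reconPoly_unitAvg_eq_add {φ : ℝ → ℝ} {m : ℕ} (hm : 0 < m) (hφ : ContDiff ℝ m φ) {R M : ℝ}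
    (hR : 0 < R) (hM : ∀ ξ ∈ Set.Icc (-R) R, |iteratedDeriv m φ ξ| ≤ M) :
    ∃ w : ℤ → ℝ, (∀ i : ℤ, |(i : ℝ)| + 1 / 2 ≤ R → |w i| ≤ M * (2 * R) ^ m) ∧
      ∀ a : ℤ, reconPoly a m (unitAvg φ) = taylorPoly φ (-R) m + reconPoly a m w := by
  refine ⟨unitAvg (φ - fun ξ => (taylorPoly φ (-R) m).eval ξ), fun i hi => ?_, fun a => ?_⟩
  · exact abs_unitAvg_le (fun ξ hξ => abs_sub_taylorPoly_le hm hφ hR hM hξ) hi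
  · rw [unitAvg_sub hφ.continuous (Polynomial.continuous _), reconPoly_sub,
      reconPoly_unitAvg_eval hm (degree_taylorPoly_lt _ _ _)]
    ring

/-- The reconstruction is a finite combination of fixed polynomials, each bounded on the compact
unit cell, so `K` does not depend on the data. -/
theorem exists_abs_eval_iterate_derivative_reconPoly_le (a : ℤ) (m l : ℕ) :
    ∃ K, 0 ≤ K ∧ ∀ (v : ℤ → ℝ) (A : ℝ), (∀ k < m, |v (a + (k : ℤ))| ≤ A) → 0 ≤ A →
      ∀ ξ ∈ Set.Icc (-(1 / 2) : ℝ) (1 / 2),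
        |(Polynomial.derivative^[l] (reconPoly a m v)).eval ξ| ≤ K * A := by
  have hb : ∀ k : ℕ, ∃ K, 0 ≤ K ∧ ∀ ξ ∈ Set.Icc (-(1 / 2) : ℝ) (1 / 2),
      |(Polynomial.derivative^[l] (reconBasis a m k)).eval ξ| ≤ K := by
    intro k
    obtain ⟨K, hK⟩ := (isCompact_Icc (a := (-(1 / 2) : ℝ)) (b := 1 / 2)).exists_bound_of_continuousOn
      (Polynomial.continuous (Polynomial.derivative^[l] (reconBasis a m k))).continuousOn
    exact ⟨K, (norm_nonneg _).trans (hK 0 (by norm_num)), hK⟩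
  choose K hK0 hK using hb
  refine ⟨∑ k ∈ range m, K k, sum_nonneg fun k _ => hK0 k, fun v A hv hA ξ hξ => ?_⟩
  rw [reconPoly_eq_sum, Polynomial.iterate_derivative_sum, Polynomial.eval_finsetSum, sum_mul]
  refine (abs_sum_le_sum_abs _ _).trans (sum_le_sum fun k hk => ?_)
  rw [Polynomial.iterate_derivative_smul, Polynomial.eval_smul, smul_eq_mul, abs_mul, mul_comm]
  exact mul_le_mul (hK k ξ hξ) (hv k (mem_range.1 hk)) (abs_nonneg _) (hK0 k)

theorem abs_globalCell_le {r k : ℕ} (hk : k < 2 * r - 1) :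
    |((1 - (r : ℤ) + (k : ℤ) : ℤ) : ℝ)| + 1 / 2 ≤ r := by
  have h1 : (k : ℝ) + 2 ≤ 2 * r := by exact_mod_cast (by omega : k + 2 ≤ 2 * r)
  have : |((1 - (r : ℤ) + (k : ℤ) : ℤ) : ℝ)| ≤ r - 1 := by
    push_cast
    rw [abs_le]
    constructor <;> linarith [(Nat.cast_nonneg k : (0 : ℝ) ≤ k)]
  linarith

/-- The Taylor polynomial is reproduced exactly. What remains is the reconstruction of the remainder
and the remainder itself at `1/2`, the two summands of the constant. -/
theorem exists_abs_globalValue_unitAvg_sub_le (r : ℕ) (hr : 0 < r) :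
    ∃ K, 0 ≤ K ∧ ∀ (φ : ℝ → ℝ) (M : ℝ), ContDiff ℝ (2 * r - 1 : ℕ) φ →
      (∀ ξ ∈ Set.Icc (-(r : ℝ)) r, |iteratedDeriv (2 * r - 1) φ ξ| ≤ M) →
      |globalValue r (unitAvg φ) - φ (1 / 2)| ≤ K * M := by
  obtain ⟨K, hK0, hK⟩ := exists_abs_eval_iterate_derivative_reconPoly_le (1 - (r : ℤ)) (2 * r - 1) 0
  refine ⟨K * (2 * r) ^ (2 * r - 1) + (2 * r) ^ (2 * r - 1), by positivity, fun φ M hφ hM => ?_⟩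
  have hr' : (1 : ℝ) ≤ r := by exact_mod_cast hr
  have hM0 : 0 ≤ M := (abs_nonneg _).trans (hM 0 ⟨by linarith, by linarith⟩)
  obtain ⟨w, hw, hrec⟩ := reconPoly_unitAvg_eq_add (m := 2 * r - 1) (by omega) hφ
    (by positivity : (0 : ℝ) < r) hM
  have h1 := hK w _ (fun k hk => hw _ (abs_globalCell_le hk)) (by positivity) (1 / 2) (by norm_num)
  have h2 := abs_sub_taylorPoly_le (by omega : 0 < 2 * r - 1) hφ (by positivity : (0 : ℝ) < r) hM
    (ξ := 1 / 2) ⟨by linarith, by linarith⟩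
  rw [globalValue, hrec, Polynomial.eval_add]
  rw [Function.iterate_zero, id] at h1
  rw [abs_le] at *
  constructor <;> linarith [h1.1, h1.2, h2.1, h2.2]

/-! ### Comparison of the smoothness indicators. -/

/-- The Jiang–Shu smoothness indicator of a polynomial. -/
def polySmoothness (r : ℕ) (p : ℝ[X]) : ℝ :=
  ∑ l ∈ Icc 1 (r - 1),
    ∫ ξ in (-(1 / 2) : ℝ)..(1 / 2), ((Polynomial.derivative^[l] p).eval ξ) ^ 2

theorem smoothness_eq {r : ℕ} (s : Fin r) (v : ℤ → ℝ) :
    smoothness s v = polySmoothness r (subPoly s v) := rfl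

theorem integral_sq_nonneg (p : ℝ[X]) :
    0 ≤ ∫ ξ in (-(1 / 2) : ℝ)..(1 / 2), (p.eval ξ) ^ 2 :=
  integral_nonneg (by norm_num) fun _ _ => sq_nonneg _

theorem polySmoothness_nonneg (r : ℕ) (p : ℝ[X]) : 0 ≤ polySmoothness r p :=
  sum_nonneg fun _ _ => integral_sq_nonneg _

theorem integral_sq_le_polySmoothness {r l : ℕ} (hl : l ∈ Icc 1 (r - 1)) (p : ℝ[X]) :
    ∫ ξ in (-(1 / 2) : ℝ)..(1 / 2), ((Polynomial.derivative^[l] p).eval ξ) ^ 2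
      ≤ polySmoothness r p :=
  single_le_sum (f := fun l => ∫ ξ in (-(1 / 2) : ℝ)..(1 / 2),
    ((Polynomial.derivative^[l] p).eval ξ) ^ 2) (fun _ _ => integral_sq_nonneg _) hl

/-- Young's inequality with a free parameter: a small `t` keeps the leading factor as close to 1 as
the ratio estimate needs. -/
theorem polySmoothness_add_le (r : ℕ) (p q : ℝ[X]) {t : ℝ} (ht : 0 < t) :
    polySmoothness r (p + q)
      ≤ (1 + t) * polySmoothness r p + (1 + 1 / t) * polySmoothness r q := by
  have hint : ∀ p : ℝ[X], IntervalIntegrable (fun ξ => (p.eval ξ) ^ 2) MeasureTheory.volume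
      (-(1 / 2) : ℝ) (1 / 2) := fun p => (p.continuous.pow 2).intervalIntegrable _ _
  unfold polySmoothness
  rw [mul_sum, mul_sum, ← sum_add_distrib]
  refine sum_le_sum fun l _ => ?_
  rw [← intervalIntegral.integral_const_mul, ← intervalIntegral.integral_const_mul,
    ← intervalIntegral.integral_add ((hint _).const_mul _) ((hint _).const_mul _)]
  refine integral_mono_on (by norm_num) (hint _)
    (((hint _).const_mul _).add ((hint _).const_mul _)) fun ξ _ => ?_
  rw [iterate_map_add, Polynomial.eval_add]
  generalize (Polynomial.derivative^[l] p).eval ξ = a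
  generalize (Polynomial.derivative^[l] q).eval ξ = b
  have h : (1 + t) * a ^ 2 + (1 + 1 / t) * b ^ 2 - (a + b) ^ 2 = (t * a - b) ^ 2 / t := by
    field_simp
    ring
  have : 0 ≤ (t * a - b) ^ 2 / t := by positivity
  linarith

theorem polySmoothness_le_of_abs_le {r : ℕ} {p : ℝ[X]} {A : ℝ}
    (h : ∀ l ∈ Icc 1 (r - 1), ∀ ξ ∈ Set.Icc (-(1 / 2) : ℝ) (1 / 2),
      |(Polynomial.derivative^[l] p).eval ξ| ≤ A) :
    polySmoothness r p ≤ (r - 1 : ℕ) * A ^ 2 := by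
  unfold polySmoothness
  refine (sum_le_card_nsmul _ _ (A ^ 2) fun l hl => ?_).trans (by simp)
  have := integral_mono_on (f := fun ξ => ((Polynomial.derivative^[l] p).eval ξ) ^ 2)
    (g := fun _ => A ^ 2) (μ := MeasureTheory.volume) (a := -(1 / 2 : ℝ)) (b := 1 / 2) (by norm_num)
    (((Polynomial.continuous _).pow 2).intervalIntegrable _ _)
    (continuous_const.intervalIntegrable _ _)
    (fun ξ hξ => sq_le_sq.2 ((h l hl ξ hξ).trans (le_abs_self A)))
  refine this.trans (le_of_eq ?_)
  rw [intervalIntegral.integral_const]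
  norm_num

/-- A polynomial all of whose derivatives are bounded in mean square on the unit cell is bounded
on every interval. -/
theorem exists_abs_eval_le_of_integral_sq_le (m : ℕ) {R : ℝ} (hR : 1 / 2 ≤ R) :
    ∃ K, 0 ≤ K ∧ ∀ (p : ℝ[X]) (A : ℝ), p.degree < m → 0 ≤ A →
      (∀ l < m, ∫ ξ in (-(1 / 2) : ℝ)..(1 / 2), ((Polynomial.derivative^[l] p).eval ξ) ^ 2
        ≤ A ^ 2) → ∀ ξ ∈ Set.Icc (-R) R, |p.eval ξ| ≤ K * A := by
  induction m with
  | zero =>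
    refine ⟨0, le_rfl, fun p A hp hA _ ξ _ => ?_⟩
    have : p = 0 := by simpa using hp
    simp [this]
  | succ m ih =>
    obtain ⟨K, hK0, hK⟩ := ih
    refine ⟨1 + K * (2 * R), by positivity, fun p A hp hA h ξ hξ => ?_⟩
    have hd : p.derivative.degree < m := by
      by_cases h0 : p = 0
      · simp [h0]
      · by_contra hcon
        have h1 := Polynomial.degree_derivative_lt h0
        have h2 : ((m : ℕ) : WithBot ℕ) < p.degree := (not_lt.1 hcon).trans_lt h1
        rw [Polynomial.degree_eq_natDegree h0] at hp h2
        have h3 : p.natDegree < m + 1 := by exact_mod_cast hp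
        have h4 : m < p.natDegree := by exact_mod_cast h2
        omega
    have hK' := hK p.derivative A hd hA fun l hl => by
      simpa only [← Function.iterate_succ_apply] using h (l + 1) (by omega)
    -- The cell has length 1, so `|p| > A` throughout would make the mean square exceed `A ^ 2`.
    -- From `c`, the bound on the derivative carries over to all of `[-R, R]`.
    obtain ⟨c, hc, hcA⟩ : ∃ c ∈ Set.Icc (-(1 / 2) : ℝ) (1 / 2), |p.eval c| ≤ A := by
      by_contra! hcon
      have h0 := h 0 (by omega)
      have h1 : ∫ ξ in (-(1 / 2) : ℝ)..(1 / 2), A ^ 2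
          < ∫ ξ in (-(1 / 2) : ℝ)..(1 / 2), ((Polynomial.derivative^[0] p).eval ξ) ^ 2 := by
        refine integral_lt_integral_of_continuousOn_of_le_of_exists_lt (by norm_num)
          continuousOn_const ((Polynomial.continuous _).pow 2).continuousOn ?_ ?_
        · intro x hx
          have := hcon x ⟨hx.1.le, hx.2⟩
          exact (sq_lt_sq.2 (by rwa [abs_of_nonneg hA])).le
        · refine ⟨0, by norm_num, ?_⟩
          have := hcon 0 (by norm_num)
          exact sq_lt_sq.2 (by rwa [abs_of_nonneg hA])
      rw [intervalIntegral.integral_const] at h1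
      norm_num at h1 h0
      linarith
    have hcR : c ∈ Set.Icc (-R) R := ⟨by linarith [hc.1], by linarith [hc.2]⟩
    have hmv := Convex.norm_image_sub_le_of_norm_hasDerivWithin_le (f := fun x => p.eval x)
      (f' := fun x => p.derivative.eval x) (C := K * A) (fun x _ => (p.hasDerivAt x).hasDerivWithinAt)
      hK' (convex_Icc (-R) R) hcR hξ
    have hdist : ‖ξ - c‖ ≤ 2 * R := by
      rw [Real.norm_eq_abs, abs_le]
      constructor <;> linarith [hξ.1, hξ.2, hcR.1, hcR.2]
    have h2 : |p.eval ξ - p.eval c| ≤ K * A * (2 * R) :=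
      hmv.trans (by gcongr)
    have h3 := abs_add_le (p.eval ξ - p.eval c) (p.eval c)
    rw [sub_add_cancel] at h3
    linarith

/-- As `n ≥ 1`, all derivatives of `p^(n)` of order below `r - n`, itself included, occur in the
indicator, which therefore controls `p^(n)` though it ignores constants. -/
theorem exists_sq_eval_iterate_derivative_le {r n : ℕ} (hn : n ∈ Icc 1 (r - 1)) :
    ∃ K, 0 < K ∧ ∀ p : ℝ[X], p.degree < r → ∀ ξ ∈ Set.Icc (-(r : ℝ)) r,
      ((Polynomial.derivative^[n] p).eval ξ) ^ 2 ≤ K * polySmoothness r p := by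
  rw [mem_Icc] at hn
  have hr : (1 : ℝ) ≤ r := by exact_mod_cast (by omega : 1 ≤ r)
  obtain ⟨K, hK0, hK⟩ := exists_abs_eval_le_of_integral_sq_le (r - n) (R := r) (by linarith)
  refine ⟨K ^ 2 + 1, by positivity, fun p hp ξ hξ => ?_⟩
  have hB := polySmoothness_nonneg r p
  have hdeg : ∀ l, l ≤ r → (Polynomial.derivative^[l] p).degree < ((r - l : ℕ) : WithBot ℕ) := by
    intro l hl
    rw [Polynomial.degree_lt_iff_coeff_zero] at hp ⊢
    intro i hi
    rw [Polynomial.coeff_iterate_derivative, hp _ (by omega), smul_zero]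
  have h := hK (Polynomial.derivative^[n] p) (√(polySmoothness r p)) (hdeg n (by omega))
    (Real.sqrt_nonneg _) (fun l hl => by
      rw [Real.sq_sqrt hB, ← Function.iterate_add_apply]
      exact integral_sq_le_polySmoothness (mem_Icc.2 (by omega)) p) ξ hξ
  calc ((Polynomial.derivative^[n] p).eval ξ) ^ 2 ≤ (K * √(polySmoothness r p)) ^ 2 :=
        sq_le_sq.2 (h.trans (le_abs_self _))
    _ = K ^ 2 * polySmoothness r p := by rw [mul_pow, Real.sq_sqrt hB]
    _ ≤ _ := by nlinarith

theorem subCell_eq {r : ℕ} (s : Fin r) (k : ℕ) :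
    (s : ℤ) - (r : ℤ) + 1 + (k : ℤ) = 1 - (r : ℤ) + ((s + k : ℕ) : ℤ) := by
  push_cast
  ring

/-- If the `r`th derivative is small, all smoothness indicators are close to the one of the Taylor
polynomial. -/
theorem exists_smoothness_unitAvg_bound (r : ℕ) :
    ∃ K, 0 ≤ K ∧ ∀ (φ : ℝ → ℝ) (M : ℝ), ContDiff ℝ r φ →
      (∀ ξ ∈ Set.Icc (-(r : ℝ)) r, |iteratedDeriv r φ ξ| ≤ M) → ∀ s : Fin r, ∀ t : ℝ, 0 < t →
      smoothness s (unitAvg φ) ≤ (1 + t) * polySmoothness r (taylorPoly φ (-r) r)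
          + (1 + 1 / t) * (K * M ^ 2) ∧
      polySmoothness r (taylorPoly φ (-r) r) ≤ (1 + t) * smoothness s (unitAvg φ)
          + (1 + 1 / t) * (K * M ^ 2) := by
  choose K hK0 hK using fun (s : Fin r) (l : ℕ) =>
    exists_abs_eval_iterate_derivative_reconPoly_le ((s : ℤ) - (r : ℤ) + 1) r l
  set L : ℝ := ∑ s : Fin r, ∑ l ∈ Icc 1 (r - 1), K s l with hL
  have hKL : ∀ s, ∀ l ∈ Icc 1 (r - 1), K s l ≤ L := fun s l hl =>
    (single_le_sum (f := K s) (fun l _ => hK0 s l) hl).trans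
      (single_le_sum (f := fun s => ∑ l ∈ Icc 1 (r - 1), K s l)
        (fun s _ => sum_nonneg fun l _ => hK0 s l) (mem_univ s))
  refine ⟨(r - 1 : ℕ) * (L * (2 * r) ^ r) ^ 2, by positivity, fun φ M hφ hM s t ht => ?_⟩
  have hr : 0 < r := Fin.pos s
  have hr' : (0 : ℝ) < r := by exact_mod_cast hr
  have hM0 : 0 ≤ M := (abs_nonneg _).trans (hM 0 ⟨by linarith, by linarith⟩)
  obtain ⟨w, hw, hrec⟩ := reconPoly_unitAvg_eq_add hr hφ hr' hM
  have hcell : ∀ k < r, |w ((s : ℤ) - (r : ℤ) + 1 + (k : ℤ))| ≤ M * (2 * r) ^ r := fun k hk => by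
    rw [subCell_eq]
    exact hw _ (abs_globalCell_le (by have := s.2; omega))
  have hq : ∀ l ∈ Icc 1 (r - 1), ∀ ξ ∈ Set.Icc (-(1 / 2) : ℝ) (1 / 2),
      |(Polynomial.derivative^[l] (subPoly s w)).eval ξ| ≤ L * (M * (2 * r) ^ r) :=
    fun l hl ξ hξ => (hK s l w _ hcell (by positivity) ξ hξ).trans (by gcongr; exact hKL s l hl)
  have hB := polySmoothness_le_of_abs_le hq
  -- The reverse inequality writes the Taylor polynomial as the reconstruction minus the
  -- perturbation.
  have hB' := polySmoothness_le_of_abs_le (r := r) (p := -subPoly s w)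
    (A := L * (M * (2 * r) ^ r)) (by simpa only [Polynomial.iterate_derivative_neg,
      Polynomial.eval_neg, abs_neg] using hq)
  have heq : ((r - 1 : ℕ) : ℝ) * (L * (M * (2 * r) ^ r)) ^ 2
      = (r - 1 : ℕ) * (L * (2 * r) ^ r) ^ 2 * M ^ 2 := by ring
  rw [heq] at hB hB'
  have hsub : subPoly s (unitAvg φ) = taylorPoly φ (-r) r + subPoly s w := hrec _
  have hsub' : taylorPoly φ (-r) r = subPoly s (unitAvg φ) + -subPoly s w := by
    rw [hsub]; ring
  have ht' : 0 ≤ 1 + 1 / t := by positivity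
  constructor
  · rw [smoothness_eq, hsub]
    exact (polySmoothness_add_le r _ _ ht).trans (by gcongr)
  · rw [smoothness_eq]
    conv_lhs => rw [hsub']
    exact (polySmoothness_add_le r _ _ ht).trans (by gcongr)

/-- If the `r`th derivative is small compared with a derivative of lower positive order, all
smoothness indicators are close to each other. -/
theorem exists_smoothness_unitAvg_ratio {r n : ℕ} (hn : n ∈ Icc 1 (r - 1)) {q : ℝ} (hq : 1 < q) :
    ∃ κ > 0, ∀ (φ : ℝ → ℝ) (M : ℝ), ContDiff ℝ r φ →
      (∀ ξ ∈ Set.Icc (-(r : ℝ)) r, |iteratedDeriv r φ ξ| ≤ M) →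
      M ^ 2 ≤ κ * (iteratedDeriv n φ (-r)) ^ 2 → iteratedDeriv n φ (-r) ≠ 0 →
      ∃ b > 0, ∀ s : Fin r, smoothness s (unitAvg φ) ≤ q * b ∧
        b ≤ q * smoothness s (unitAvg φ) := by
  obtain ⟨K, hK0, hK⟩ := exists_smoothness_unitAvg_bound r
  obtain ⟨L, hL0, hL⟩ := exists_sq_eval_iterate_derivative_le hn
  -- For `t ≤ 1/2` one has `(1 + t) / (1 - t) ≤ 1 + 4t`, and `1 + 4t ≤ q`.
  set t : ℝ := min (1 / 2) ((q - 1) / 4) with ht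
  have ht0 : 0 < t := lt_min (by norm_num) (by linarith)
  have ht1 : t ≤ 1 / 2 := min_le_left _ _
  have ht2 : 1 + 4 * t ≤ q := by linarith [min_le_right (1 / 2) ((q - 1) / 4)]
  have hden : 0 < (1 + 1 / t) * (K + 1) * L := by positivity
  -- Chosen so that the perturbation contributes at most `t * b`; `K + 1` avoids a zero denominator.
  refine ⟨t / ((1 + 1 / t) * (K + 1) * L), by positivity, fun φ M hφ hM hMn hn0 => ?_⟩
  have hr' : (0 : ℝ) ≤ r := by positivity
  have hnr : n < r := by rw [mem_Icc] at hn; omega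
  have hb := hL _ (degree_taylorPoly_lt φ (-r) r) (-r) ⟨le_rfl, by linarith⟩
  rw [eval_iterate_derivative_taylorPoly _ _ hnr] at hb
  set b := polySmoothness r (taylorPoly φ (-r) r) with hbdef
  have hb0 : 0 < b := by
    have : 0 < (iteratedDeriv n φ (-r)) ^ 2 := by positivity
    exact pos_of_mul_pos_right (this.trans_le hb) hL0.le
  have herr : (1 + 1 / t) * (K * M ^ 2) ≤ t * b := by
    calc (1 + 1 / t) * (K * M ^ 2) ≤ (1 + 1 / t) * ((K + 1) * M ^ 2) := by gcongr; linarith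
      _ ≤ (1 + 1 / t) * ((K + 1) * (t / ((1 + 1 / t) * (K + 1) * L) * (L * b))) := by
        gcongr
        exact hMn.trans (by gcongr)
      _ = t * b := by field_simp
  refine ⟨b, hb0, fun s => ?_⟩
  obtain ⟨h1, h2⟩ := hK φ M hφ hM s t ht0
  have hs0 : 0 ≤ smoothness s (unitAvg φ) := polySmoothness_nonneg _ _
  constructor
  · nlinarith
  · have h3 : (1 - t) * b ≤ (1 + t) * smoothness s (unitAvg φ) := by linarith
    have h4 : (1 + t) ≤ (1 + 4 * t) * (1 - t) := by nlinarith
    have h5 : (1 - t) * b ≤ (1 - t) * ((1 + 4 * t) * smoothness s (unitAvg φ)) := by nlinarith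
    have h6 := le_of_mul_le_mul_left h5 (by linarith)
    nlinarith

/-! ### The nonlinear weights. -/

theorem sum_eq_one_of_isIdealWeights {r : ℕ} (hr : 0 < r) {d : Fin r → ℝ}
    (hd : IsIdealWeights d) : ∑ s, d s = 1 := by
  have h1 : unitAvg (fun ξ => (1 : ℝ[X]).eval ξ) = fun _ => 1 := by
    funext i
    simp only [unitAvg, Polynomial.eval_one, intervalIntegral.integral_const]
    norm_num
  have hrec : ∀ (a : ℤ) (m : ℕ), 0 < m → reconPoly a m (fun _ => 1) = 1 := fun a m hm => by
    rw [← h1]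
    refine reconPoly_unitAvg_eval hm ?_ a
    rw [Polynomial.degree_one]
    exact_mod_cast hm
  have h := hd fun _ => 1
  simpa [subValue, subPoly, globalValue, hrec _ r hr, hrec _ (2 * r - 1) (by omega)] using h

/-- On both sides of `d` the argument of `sgm` stays at distance at least `δ` from 0, so `sgm` is
exactly `1` on the left branch and `-1` on the right one; both branches give `d`. -/
theorem gACM_eq_of_abs_sub_le {B d CFS δ ρ w : ℝ} {k : ℕ} (hδ : 0 < δ) (h1 : ρ + δ ≤ d - CFS)
    (h2 : ρ + δ ≤ CFSbar d CFS - d) (hw : |w - d| ≤ ρ) : gACM B k d CFS δ w = d := by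
  rw [abs_le] at hw
  unfold gACM sgm
  split_ifs with hwd hx hx
  · have hpos : 0 < w - CFS := by linarith
    rw [abs_of_pos hpos, div_self hpos.ne']
    ring
  · exact absurd (le_trans (by linarith) (le_abs_self _)) hx
  · have hneg : w - CFSbar d CFS < 0 := by linarith
    rw [abs_of_neg hneg, div_neg, div_self hneg.ne]
    ring
  · exact absurd (le_trans (by linarith) (neg_le_abs _)) hx

theorem exists_gMOPACM_eq {r : ℕ} [NeZero r] {B : ℝ} {k : ℕ} {d CFS δ : Fin r → ℝ}
    (h : ACMAdmissible B k d CFS δ) :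
    ∃ ρ > 0, ∀ s, ∀ w, |w - d s| ≤ ρ → gMOPACM B k d CFS δ w = d s := by
  -- The nearest index `i` may differ from `s` when ideal weights coincide. It suffices that `ρ` is
  -- below half of every nonzero gap: then `d i = d s`, and the mapping with the parameters of `i`
  -- returns this common value.
  have hex : ∀ i s : Fin r, ∃ ρ > 0, ρ + δ i ≤ d i - CFS i ∧
      ρ + δ i ≤ CFSbar (d i) (CFS i) - d i ∧ (|d i - d s| ≤ 2 * ρ → d i = d s) := by
    intro i s
    have hlt := h.delta_lt i
    simp only [lt_min_iff] at hlt
    obtain ⟨⟨-, h1⟩, h2, -⟩ := hlt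
    have hd0 : d i ≠ 0 := ((h.CFS_mem i).1.trans (h.CFS_mem i).2).ne'
    have h3 : (1 - d i) * (1 - CFS i / d i) = CFSbar (d i) (CFS i) - d i := by
      unfold CFSbar
      field_simp
      ring
    rw [h3] at h2
    by_cases his : d i = d s
    · set ρ := min (d i - CFS i - δ i) (CFSbar (d i) (CFS i) - d i - δ i)
      have e1 : ρ ≤ d i - CFS i - δ i := min_le_left _ _
      have e2 : ρ ≤ CFSbar (d i) (CFS i) - d i - δ i := min_le_right _ _
      exact ⟨ρ, lt_min (by linarith) (by linarith), by linarith, by linarith, fun _ => his⟩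
    · have hpos : 0 < |d i - d s| := abs_pos.2 (sub_ne_zero.2 his)
      set ρ := min (min (d i - CFS i - δ i) (CFSbar (d i) (CFS i) - d i - δ i))
        (|d i - d s| / 4)
      have e1 : ρ ≤ d i - CFS i - δ i := (min_le_left _ _).trans (min_le_left _ _)
      have e2 : ρ ≤ CFSbar (d i) (CFS i) - d i - δ i := (min_le_left _ _).trans (min_le_right _ _)
      have e3 : ρ ≤ |d i - d s| / 4 := min_le_right _ _
      exact ⟨ρ, lt_min (lt_min (by linarith) (by linarith)) (by linarith), by linarith,
        by linarith, fun hle => by linarith⟩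
  choose ρ hρ0 hρ1 hρ2 hρ3 using hex
  obtain ⟨p, -, hp⟩ := Finset.exists_min_image univ (fun p : Fin r × Fin r => ρ p.1 p.2)
    univ_nonempty
  refine ⟨ρ p.1 p.2, hρ0 _ _, fun s w hw => ?_⟩
  have hmem := min'_mem _ (nearestIndices_nonempty d w)
  unfold gMOPACM minDist
  generalize (nearestIndices d w).min' (nearestIndices_nonempty d w) = i at hmem ⊢
  have hi : |w - d i| ≤ |w - d s| := by
    simp only [nearestIndices, mem_filter, mem_univ, true_and] at hmem
    exact hmem s
  have hle : ρ p.1 p.2 ≤ ρ i s := hp (i, s) (mem_univ _)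
  have hds : d i = d s := by
    refine hρ3 i s ?_
    have h1 := abs_sub_le (d i) w (d s)
    rw [abs_sub_comm (d i) w] at h1
    linarith
  rw [← hds]
  exact gACM_eq_of_abs_sub_le (h.delta_pos i) (hρ1 i s) (hρ2 i s) ((hi.trans hw).trans hle)

/-- With `E = ε + b`, each `ε + β_l` is within a factor `q` of `E`. Squaring gives `q ^ 2` for the
numerator and again for the denominator, hence `q ^ 4`. -/
theorem abs_omegaJS_sub_le {r : ℕ} {d : Fin r → ℝ} (hd0 : ∀ s, 0 < d s) (hd1 : ∑ s, d s = 1)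
    {ε q b : ℝ} (hε : 0 ≤ ε) (hq : 1 ≤ q) (hb : 0 < b) {v : ℤ → ℝ}
    (h1 : ∀ s : Fin r, smoothness s v ≤ q * b) (h2 : ∀ s : Fin r, b ≤ q * smoothness s v)
    (s : Fin r) : |omegaJS d ε v s - d s| ≤ q ^ 4 - 1 := by
  have hq0 : 0 < q := by linarith
  set E := ε + b with hE
  have hE0 : 0 < E := by positivity
  have hβ : ∀ l : Fin r, 0 < smoothness l v := fun l =>
    pos_of_mul_pos_right (hb.trans_le (h2 l)) hq0.le
  have e1 : ∀ l : Fin r, ε + smoothness l v ≤ q * E := fun l => by nlinarith [h1 l]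
  have e2 : ∀ l : Fin r, E ≤ q * (ε + smoothness l v) := fun l => by nlinarith [h2 l]
  have a1 : ∀ l : Fin r, alphaJS d ε v l ≤ d l * (q ^ 2 / E ^ 2) := fun l => by
    have hp : 0 < ε + smoothness l v := by linarith [hβ l]
    unfold alphaJS
    rw [← mul_div_assoc, div_le_div_iff₀ (by positivity) (by positivity), mul_assoc]
    have := pow_le_pow_left₀ hE0.le (e2 l) 2
    rw [mul_pow] at this
    exact mul_le_mul_of_nonneg_left this (hd0 l).le
  have a2 : ∀ l : Fin r, d l * (1 / (q ^ 2 * E ^ 2)) ≤ alphaJS d ε v l := fun l => by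
    have hp : 0 < ε + smoothness l v := by linarith [hβ l]
    unfold alphaJS
    rw [mul_one_div, div_le_div_iff₀ (by positivity) (by positivity)]
    have := pow_le_pow_left₀ hp.le (e1 l) 2
    rw [mul_pow] at this
    exact mul_le_mul_of_nonneg_left this (hd0 l).le
  have s1 : ∑ l, alphaJS d ε v l ≤ q ^ 2 / E ^ 2 := by
    refine (sum_le_sum fun l _ => a1 l).trans ?_
    rw [← sum_mul, hd1, one_mul]
  have s2 : 1 / (q ^ 2 * E ^ 2) ≤ ∑ l, alphaJS d ε v l := by
    refine le_trans ?_ (sum_le_sum fun l _ => a2 l)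
    rw [← sum_mul, hd1, one_mul]
  have hS : 0 < ∑ l, alphaJS d ε v l := lt_of_lt_of_le (by positivity) s2
  have hds1 : d s ≤ 1 := hd1 ▸ single_le_sum (fun l _ => (hd0 l).le) (mem_univ s)
  have hs0 := hd0 s
  have hq4 : 1 ≤ q ^ 4 := one_le_pow₀ hq
  have b1 : omegaJS d ε v s ≤ d s * q ^ 4 := by
    unfold omegaJS
    rw [div_le_iff₀ hS]
    calc alphaJS d ε v s ≤ d s * (q ^ 2 / E ^ 2) := a1 s
      _ = d s * q ^ 4 * (1 / (q ^ 2 * E ^ 2)) := by field_simp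
      _ ≤ _ := by gcongr
  have b2 : d s ≤ q ^ 4 * omegaJS d ε v s := by
    unfold omegaJS
    rw [← mul_div_assoc, le_div_iff₀ hS]
    calc d s * ∑ l, alphaJS d ε v l ≤ d s * (q ^ 2 / E ^ 2) := by gcongr
      _ = q ^ 4 * (d s * (1 / (q ^ 2 * E ^ 2))) := by field_simp
      _ ≤ _ := by gcongr; exact a2 s
  rw [abs_le]
  constructor
  · by_contra! hcon
    nlinarith
  · nlinarith

/-- If the smoothness indicators are close to each other, the nonlinear weights are the ideal
weights. -/
theorem exists_reconMOPACM_eq_globalValue {r : ℕ} [NeZero r] {d : Fin r → ℝ}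
    (hd : IsIdealWeights d) {B : ℝ} {k : ℕ} {CFS δ : Fin r → ℝ}
    (h : ACMAdmissible B k d CFS δ) :
    ∃ q > 1, ∀ ε : ℝ, 0 ≤ ε → ∀ v : ℤ → ℝ,
      (∃ b > 0, ∀ s : Fin r, smoothness s v ≤ q * b ∧ b ≤ q * smoothness s v) →
      reconMOPACM B k d CFS δ ε v = globalValue r v := by
  obtain ⟨ρ, hρ, hg⟩ := exists_gMOPACM_eq h
  have hd1 := sum_eq_one_of_isIdealWeights (Nat.pos_of_neZero r) hd
  have hd0 : ∀ s, 0 < d s := fun s => (h.CFS_mem s).1.trans (h.CFS_mem s).2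
  obtain ⟨q, hq1, hq⟩ : ∃ q : ℝ, 1 < q ∧ q ^ 4 - 1 ≤ ρ := by
    refine ⟨(1 + ρ) ^ ((1 : ℝ) / 4), Real.one_lt_rpow (by linarith) (by norm_num), ?_⟩
    rw [← Real.rpow_natCast, ← Real.rpow_mul (by linarith)]
    norm_num
  refine ⟨q, hq1, fun ε hε v ⟨b, hb, hs⟩ => ?_⟩
  have hα : ∀ s, alphaMOPACM B k d CFS δ ε v s = d s := fun s =>
    hg s _ ((abs_omegaJS_sub_le hd0 hd1 hε hq1.le hb (fun s => (hs s).1) (fun s => (hs s).2) s).trans hq)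
  rw [← hd v]
  simp only [reconMOPACM, omegaMOPACM, hα, hd1, div_one]

/-! ### Localisation and rescaling. -/

/-- Multiplication by a bump function. The order is finite because smoothness at a point gives a
neighbourhood for each finite order, not a common one. -/
theorem exists_contDiff_hasCompactSupport_eventuallyEq {u : ℝ → ℝ} {x₀ : ℝ}
    (hu : ContDiffAt ℝ ∞ u x₀) (n : ℕ) :
    ∃ w : ℝ → ℝ, ContDiff ℝ n w ∧ HasCompactSupport w ∧ w =ᶠ[𝓝 x₀] u := by
  have hn : ContDiffAt ℝ n u x₀ := hu.of_le (by exact_mod_cast le_top)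
  obtain ⟨R, hR, hball⟩ := Metric.eventually_nhds_iff_ball.1
    (hn.eventually (by exact_mod_cast ENat.natCast_ne_top n))
  let b : ContDiffBump x₀ := ⟨R / 3, R / 2, by linarith, by linarith⟩
  refine ⟨fun x => b x * u x, ?_, b.hasCompactSupport.mul_right, ?_⟩
  · rw [contDiff_iff_contDiffAt]
    intro x
    by_cases hx : x ∈ Metric.ball x₀ R
    · exact b.contDiff.contDiffAt.mul (hball x hx)
    · have hx' : x ∉ tsupport b := by
        rw [b.tsupport_eq]
        exact fun hcon => hx (Metric.closedBall_subset_ball (by change R / 2 < R; linarith) hcon)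
      have h0 : (fun x => b x * u x) =ᶠ[𝓝 x] fun _ => 0 := by
        filter_upwards [notMem_tsupport_iff_eventuallyEq.1 hx'] with y hy
        simp [hy]
      exact contDiffAt_const.congr_of_eventuallyEq h0
  · filter_upwards [b.eventuallyEq_one] with y hy
    simp [hy]

theorem exists_abs_iteratedDeriv_le {u : ℝ → ℝ} {n : ℕ} (hu : ContDiff ℝ n u)
    (hc : HasCompactSupport u) : ∃ M, 0 ≤ M ∧ ∀ x, |iteratedDeriv n u x| ≤ M := by
  obtain ⟨M, hM⟩ := (hc.iteratedFDeriv (𝕜 := ℝ) n).exists_bound_of_continuous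
    (hu.continuous_iteratedFDeriv le_rfl)
  refine ⟨M, (norm_nonneg _).trans (hM 0), fun x => ?_⟩
  rw [← Real.norm_eq_abs, ← norm_iteratedFDeriv_eq_norm_iteratedDeriv]
  exact hM x

/-- `u` in the scaled variable `ξ = (y - x) / h`. -/
def rescale (u : ℝ → ℝ) (x h : ℝ) (ξ : ℝ) : ℝ := u (x + h * ξ)

theorem contDiff_rescale {u : ℝ → ℝ} {n : ℕ} (hu : ContDiff ℝ n u) (x h : ℝ) :
    ContDiff ℝ n (rescale u x h) := by
  unfold rescale
  fun_prop

theorem iteratedDeriv_rescale {u : ℝ → ℝ} {n : ℕ} (hu : ContDiff ℝ n u) (x h ξ : ℝ) :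
    iteratedDeriv n (rescale u x h) ξ = h ^ n * iteratedDeriv n u (x + h * ξ) := by
  have h1 : ContDiff ℝ n fun z => u (x + z) := by fun_prop
  have h2 := congrFun (iteratedDeriv_comp_const_mul h1 h) ξ
  rw [iteratedDeriv_comp_const_add] at h2
  exact h2

theorem globalValue_sub (r : ℕ) (v w : ℤ → ℝ) :
    globalValue r (v - w) = globalValue r v - globalValue r w := by
  rw [globalValue, reconPoly_sub, Polynomial.eval_sub, globalValue, globalValue]

/-! ### The linear error and its dependence on the position. -/

/-- The error of the linear upstream central scheme with signed mesh width `h`. -/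
def linearError (r : ℕ) (u : ℝ → ℝ) (x h : ℝ) : ℝ :=
  globalValue r (unitAvg (rescale u x h)) - u (x + h / 2)

theorem exists_abs_linearError_le_mul (r : ℕ) (hr : 0 < r) :
    ∃ K, 0 ≤ K ∧ ∀ (u : ℝ → ℝ) (M : ℝ), ContDiff ℝ (2 * r - 1 : ℕ) u →
      (∀ x, |iteratedDeriv (2 * r - 1) u x| ≤ M) →
      ∀ x h, |linearError r u x h| ≤ K * M * |h| ^ (2 * r - 1) := by
  obtain ⟨K, hK0, hK⟩ := exists_abs_globalValue_unitAvg_sub_le r hr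
  refine ⟨K, hK0, fun u M hu hM x h => ?_⟩
  have h1 := hK (rescale u x h) (M * |h| ^ (2 * r - 1)) (contDiff_rescale hu x h) fun ξ _ => by
    rw [iteratedDeriv_rescale hu, abs_mul, abs_pow, mul_comm]
    exact mul_le_mul_of_nonneg_right (hM _) (by positivity)
  rw [mul_assoc]
  unfold linearError
  convert h1 using 3
  unfold rescale
  ring_nf

theorem linearError_sub_shift {r : ℕ} {u : ℝ → ℝ} (hu : Continuous u) (x y h : ℝ) :
    linearError r u x h - linearError r u (x - y) h
      = linearError r (fun z => u z - u (z - y)) x h := by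
  have h1 : rescale (fun z => u z - u (z - y)) x h = rescale u x h - rescale u (x - y) h := by
    funext ξ
    simp only [rescale, Pi.sub_apply]
    ring_nf
  have hc : ∀ x, Continuous (rescale u x h) := fun x => by unfold rescale; fun_prop
  unfold linearError
  rw [h1, unitAvg_sub (hc _) (hc _), globalValue_sub, show x - y + h / 2 = x + h / 2 - y by ring]
  ring

/-- The operator is linear and translation invariant, and the derivative of order `2r - 1` of `u -
u(· - y)` is `O(|y|)`; this is what the derivative of order `2r` is for. -/
theorem exists_abs_linearError_le {r : ℕ} (hr : 0 < r) {u : ℝ → ℝ} (hu : ContDiff ℝ (2 * r : ℕ) u)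
    (hc : HasCompactSupport u) :
    ∃ C, 0 ≤ C ∧ (∀ x h, |linearError r u x h| ≤ C * |h| ^ (2 * r - 1)) ∧
      ∀ x y h, |linearError r u x h - linearError r u (x - y) h|
        ≤ C * |y| * |h| ^ (2 * r - 1) := by
  obtain ⟨K, hK0, hK⟩ := exists_abs_linearError_le_mul r hr
  have hu' : ContDiff ℝ (2 * r - 1 : ℕ) u := hu.of_le (by exact_mod_cast Nat.sub_le _ _)
  obtain ⟨M, hM0, hM⟩ := exists_abs_iteratedDeriv_le hu' hc
  obtain ⟨M', hM'0, hM'⟩ := exists_abs_iteratedDeriv_le hu hc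
  refine ⟨K * M + K * M', by positivity, fun x h => ?_, fun x y h => ?_⟩
  · refine (hK u M hu' hM x h).trans ?_
    gcongr
    nlinarith
  · rw [linearError_sub_shift hu.continuous]
    have hs : ContDiff ℝ (2 * r - 1 : ℕ) fun z => u (z - y) := by fun_prop
    refine (hK _ (M' * |y|) (hu'.sub hs) (fun z => ?_) x h).trans ?_
    · rw [iteratedDeriv_fun_sub hu'.contDiffAt hs.contDiffAt, iteratedDeriv_comp_sub_const]
      have hd : ∀ w ∈ Set.univ, DifferentiableAt ℝ (iteratedDeriv (2 * r - 1) u) w := fun w _ =>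
        hu.differentiable_iteratedDeriv _ (by exact_mod_cast (by omega)) w
      have := Convex.norm_image_sub_le_of_norm_deriv_le hd (C := M') (fun w _ => by
        rw [← iteratedDeriv_succ, Nat.sub_add_cancel (by omega)]
        exact hM' w) convex_univ (Set.mem_univ (z - y)) (Set.mem_univ z)
      simpa using this
    · rw [← mul_assoc]
      gcongr
      nlinarith

theorem exists_smoothness_rescale_ratio {r n : ℕ} (hn : n ∈ Icc 1 (r - 1)) {u : ℝ → ℝ}
    (hu : ContDiff ℝ r u) (hc : HasCompactSupport u) {x₀ : ℝ} (hx₀ : iteratedDeriv n u x₀ ≠ 0)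
    {q : ℝ} (hq : 1 < q) :
    ∃ h₀ > 0, ∃ η > 0, ∀ x h : ℝ, |x - x₀| < η → h ≠ 0 → |h| < h₀ →
      ∃ b > 0, ∀ s : Fin r, smoothness s (unitAvg (rescale u x h)) ≤ q * b ∧
        b ≤ q * smoothness s (unitAvg (rescale u x h)) := by
  obtain ⟨κ, hκ, H⟩ := exists_smoothness_unitAvg_ratio hn hq
  obtain ⟨M, hM0, hM⟩ := exists_abs_iteratedDeriv_le hu hc
  rw [mem_Icc] at hn
  have hun : ContDiff ℝ n u := hu.of_le (by exact_mod_cast (by omega : n ≤ r))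
  set μ := |iteratedDeriv n u x₀| / 2 with hμ
  have hμ0 : 0 < μ := by positivity
  have hcont : Continuous fun x => |iteratedDeriv n u x| :=
    (hun.continuous_iteratedDeriv n le_rfl).abs
  obtain ⟨η, hη, hηb⟩ := Metric.eventually_nhds_iff.1
    (hcont.continuousAt.eventually_const_lt (by linarith : μ < |iteratedDeriv n u x₀|))
  have hr : (0 : ℝ) < r := by exact_mod_cast (by omega : 0 < r)
  -- The second bound keeps the expansion point `x - r h` within `η` of `x₀`; the third gives `M ^ 2
  -- * |h| ^ 2 ≤ κ * μ ^ 2`.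
  refine ⟨min 1 (min (η / (2 * r)) (κ * μ ^ 2 / (M ^ 2 + 1))), by positivity, η / 2, by positivity,
    fun x h hx hh0 hh => ?_⟩
  simp only [lt_min_iff] at hh
  obtain ⟨hh1, hh2, hh3⟩ := hh
  rw [lt_div_iff₀ (by positivity)] at hh2 hh3
  have hpos : 0 < |h| := abs_pos.2 hh0
  have hpt : μ < |iteratedDeriv n u (x + h * -(r : ℝ))| := by
    refine hηb ?_
    rw [Real.dist_eq]
    have h1 := abs_add_le (x - x₀) (h * -(r : ℝ))
    rw [abs_mul, abs_neg, abs_of_pos hr] at h1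
    rw [show x + h * -(r : ℝ) - x₀ = x - x₀ + h * -(r : ℝ) by ring]
    linarith
  refine H _ (M * |h| ^ r) (contDiff_rescale hu x h) (fun ξ _ => ?_) ?_ ?_
  · rw [iteratedDeriv_rescale hu, abs_mul, abs_pow, mul_comm]
    exact mul_le_mul_of_nonneg_right (hM _) (by positivity)
  · rw [iteratedDeriv_rescale hun, mul_pow, mul_pow, ← sq_abs (h ^ n), abs_pow,
      ← sq_abs (iteratedDeriv n u _)]
    -- Since `n ≤ r - 1`, one power of `|h|` is left to beat the constant `κ`.
    have h1 : |h| ^ r ≤ |h| ^ n * |h| := by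
      rw [← pow_succ]
      exact pow_le_pow_of_le_one hpos.le hh1.le (by omega)
    have h2 : M ^ 2 * |h| ^ 2 ≤ κ * μ ^ 2 := by
      have h3 : |h| ^ 2 ≤ |h| := by nlinarith
      have h4 := mul_le_mul_of_nonneg_left h3 (sq_nonneg M)
      linarith
    calc M ^ 2 * (|h| ^ r) ^ 2 ≤ M ^ 2 * (|h| ^ n * |h|) ^ 2 := by gcongr
      _ = (|h| ^ n) ^ 2 * (M ^ 2 * |h| ^ 2) := by ring
      _ ≤ (|h| ^ n) ^ 2 * (κ * μ ^ 2) := by gcongr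
      _ = κ * ((|h| ^ n) ^ 2 * μ ^ 2) := by ring
      _ ≤ _ := by gcongr
  · rw [iteratedDeriv_rescale hun]
    exact mul_ne_zero (pow_ne_zero _ hh0) (abs_pos.1 (hμ0.trans hpt))

/-! ### Locality of the reconstruction and passage to the mesh. -/

theorem subPoly_congr {r : ℕ} {v w : ℤ → ℝ} (h : ∀ i : ℤ, |(i : ℝ)| + 1 / 2 ≤ r → v i = w i)
    (s : Fin r) : subPoly s v = subPoly s w := by
  refine reconPoly_congr fun k hk => ?_
  rw [subCell_eq]
  exact h _ (abs_globalCell_le (by have := s.2; omega))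

theorem reconMOPACM_congr {r : ℕ} [NeZero r] {v w : ℤ → ℝ}
    (h : ∀ i : ℤ, |(i : ℝ)| + 1 / 2 ≤ r → v i = w i) (B : ℝ) (k : ℕ) (d CFS δ : Fin r → ℝ)
    (ε : ℝ) : reconMOPACM B k d CFS δ ε v = reconMOPACM B k d CFS δ ε w := by
  simp only [reconMOPACM, omegaMOPACM, alphaMOPACM, omegaJS, alphaJS, smoothness, subValue,
    subPoly_congr h]

theorem unitAvg_rescale_congr {u w : ℝ → ℝ} {x₀ η x h R : ℝ}
    (huw : ∀ y, |y - x₀| < η → u y = w y) (hx : |x - x₀| + |h| * R < η) {i : ℤ}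
    (hi : |(i : ℝ)| + 1 / 2 ≤ R) : unitAvg (rescale u x h) i = unitAvg (rescale w x h) i := by
  refine intervalIntegral.integral_congr fun ξ hξ => huw _ ?_
  rw [Set.uIcc_of_le (by linarith)] at hξ
  have h1 := abs_le.1 (le_sub_iff_add_le.2 hi)
  have h2 : |ξ| ≤ R := abs_le.2 ⟨by linarith [hξ.1], by linarith [hξ.2]⟩
  have h3 := abs_add_le (x - x₀) (h * ξ)
  rw [abs_mul] at h3
  have h4 : |h| * |ξ| ≤ |h| * R := by gcongr
  rw [show x + h * ξ - x₀ = x - x₀ + h * ξ by ring]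
  linarith

theorem center_add (xl h : ℝ) (j i : ℤ) : center xl h (j + i) = center xl h j + h * i := by
  unfold center
  push_cast
  ring

theorem unitAvg_rescale (φ : ℝ → ℝ) (x : ℝ) {h : ℝ} (hh : h ≠ 0) (i : ℤ) :
    unitAvg (rescale φ x h) i
      = (1 / h) * ∫ y in (x + h * i - h / 2)..(x + h * i + h / 2), φ y := by
  unfold unitAvg rescale
  rw [intervalIntegral.integral_comp_add_mul _ hh, smul_eq_mul, one_div h,
    show x + h * (i - 1 / 2) = x + h * i - h / 2 by ring,
    show x + h * (i + 1 / 2) = x + h * i + h / 2 by ring]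

theorem cellAvg_add (φ : ℝ → ℝ) (xl : ℝ) {h : ℝ} (hh : h ≠ 0) (j i : ℤ) :
    cellAvg φ xl h (j + i) = unitAvg (rescale φ (center xl h j) h) i := by
  rw [unitAvg_rescale _ _ hh, cellAvg, center_add]

/-- Reflection in `x_{j+1/2}` amounts to the signed width `-h` about the centre `x_j + h`, so the
estimates for `u^-` also serve `u^+`. -/
theorem cellAvg_add_one_sub (φ : ℝ → ℝ) (xl : ℝ) {h : ℝ} (hh : h ≠ 0) (j i : ℤ) :
    cellAvg φ xl h (j + 1 - i) = unitAvg (rescale φ (center xl h j + h) (-h)) i := by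
  rw [unitAvg_rescale _ _ (neg_ne_zero.2 hh), cellAvg, show j + 1 - i = j + (1 - i) by ring,
    center_add, intervalIntegral.integral_symm]
  push_cast
  rw [show center xl h j + h * (1 - i) + h / 2 = center xl h j + h + -h * i - -h / 2 by ring,
    show center xl h j + h * (1 - i) - h / 2 = center xl h j + h + -h * i + -h / 2 by ring]
  ring

/-- Near a point at which some derivative of order `1, …, r - 1` does not vanish, the
MOP-WENO-ACM reconstruction has an error of order `2r - 1` that is Lipschitz in the position. -/
theorem exists_reconMOPACM_eq_add {r : ℕ} [NeZero r] {n : ℕ} (hn : n ∈ Icc 1 (r - 1))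
    {d : Fin r → ℝ} (hd : IsIdealWeights d) {B : ℝ} {k : ℕ} {CFS δ : Fin r → ℝ}
    (hACM : ACMAdmissible B k d CFS δ) {u w : ℝ → ℝ} {x₀ : ℝ} (hw : ContDiff ℝ (2 * r : ℕ) w)
    (hwc : HasCompactSupport w) (hwu : w =ᶠ[𝓝 x₀] u) (hx₀ : iteratedDeriv n u x₀ ≠ 0) :
    ∃ C, 0 ≤ C ∧ ∃ h₀ > 0, ∃ η > 0, ∃ E : ℝ → ℝ → ℝ,
      (∀ ε : ℝ, 0 ≤ ε → ∀ x h : ℝ, |x - x₀| < η → h ≠ 0 → |h| < h₀ →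
        reconMOPACM B k d CFS δ ε (unitAvg (rescale u x h)) = u (x + h / 2) + E x h) ∧
      (∀ x h, |E x h| ≤ C * |h| ^ (2 * r - 1)) ∧
      ∀ x y h, |E x h - E (x - y) h| ≤ C * |y| * |h| ^ (2 * r - 1) := by
  have hr : 0 < r := Nat.pos_of_neZero r
  have hr' : (1 : ℝ) ≤ r := by exact_mod_cast hr
  obtain ⟨q, hq, hrecon⟩ := exists_reconMOPACM_eq_globalValue hd hACM
  obtain ⟨h₁, hh₁, η₁, hη₁, hratio⟩ := exists_smoothness_rescale_ratio hn
    (hw.of_le (by exact_mod_cast (by omega : r ≤ 2 * r))) hwc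
    (x₀ := x₀) (by rwa [hwu.iteratedDeriv_eq n]) hq
  obtain ⟨C, hC0, hC1, hC2⟩ := exists_abs_linearError_le hr hw hwc
  obtain ⟨η₂, hη₂, hwu'⟩ := Metric.eventually_nhds_iff.1 hwu
  refine ⟨C, hC0, min h₁ (η₂ / (2 * r)), by positivity, min η₁ (η₂ / 2), by positivity,
    linearError r w, fun ε hε x h hx hh0 hh => ?_, hC1, hC2⟩
  rw [lt_min_iff] at hx hh
  have hhr := hh.2
  rw [lt_div_iff₀ (by positivity)] at hhr
  have hloc : ∀ y, |y - x₀| < η₂ → u y = w y := fun y hy => (hwu' hy).symm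
  have hcell : ∀ i : ℤ, |(i : ℝ)| + 1 / 2 ≤ r →
      unitAvg (rescale u x h) i = unitAvg (rescale w x h) i := fun i hi =>
    unitAvg_rescale_congr hloc (by linarith [hx.2]) hi
  have hpt : u (x + h / 2) = w (x + h / 2) := by
    refine hloc _ ?_
    have h1 := abs_add_le (x - x₀) (h / 2)
    rw [abs_div, abs_two] at h1
    rw [show x + h / 2 - x₀ = x - x₀ + h / 2 by ring]
    nlinarith [abs_nonneg h, hx.2]
  rw [reconMOPACM_congr hcell, hrecon ε hε _ (hratio x h hx.1 hh0 hh.1), hpt, linearError]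
  ring

/-! ### Flux differences. -/

/-- Pass from `a` to `b` with `e` fixed, using that `f'` is Lipschitz, then from `e` to `e'`, using
that `f` is. -/
theorem exists_abs_increment_sub_le {f : ℝ → ℝ} (hf : ContDiff ℝ 2 f) (hc : HasCompactSupport f) :
    ∃ L, 0 ≤ L ∧ ∀ a b e e' : ℝ,
      |(f (a + e) - f a) - (f (b + e') - f b)| ≤ L * (|e - e'| + |a - b| * |e|) := by
  obtain ⟨L₁, hL₁, h1⟩ := exists_abs_iteratedDeriv_le (n := 1)
    (hf.of_le (by norm_num)) hc
  obtain ⟨L₂, hL₂, h2⟩ := exists_abs_iteratedDeriv_le (n := 2) (by exact_mod_cast hf) hc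
  have hdf : Differentiable ℝ f := hf.differentiable (by norm_num)
  have hdf' : Differentiable ℝ (deriv f) := by
    have := hf.differentiable_iteratedDeriv 1 (by norm_num)
    rwa [iteratedDeriv_one] at this
  have hlip : ∀ a b, |f a - f b| ≤ L₁ * |a - b| := fun a b =>
    Convex.norm_image_sub_le_of_norm_deriv_le (s := Set.univ) (fun x _ => hdf x)
      (fun x _ => by rw [← iteratedDeriv_one]; exact h1 x) convex_univ (Set.mem_univ _)
      (Set.mem_univ _)
  have hlip' : ∀ a b, |deriv f a - deriv f b| ≤ L₂ * |a - b| := fun a b =>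
    Convex.norm_image_sub_le_of_norm_deriv_le (s := Set.univ) (fun x _ => hdf' x)
      (fun x _ => by
        have := h2 x
        rwa [iteratedDeriv_succ, iteratedDeriv_one] at this) convex_univ (Set.mem_univ _)
      (Set.mem_univ _)
  refine ⟨L₁ + L₂, by positivity, fun a b e e' => ?_⟩
  have hA : |(f (a + e) - f (b + e)) - (f (a + 0) - f (b + 0))| ≤ L₂ * |a - b| * |e - 0| := by
    refine Convex.norm_image_sub_le_of_norm_hasDerivWithin_le (s := Set.univ)
      (f := fun t => f (a + t) - f (b + t)) (f' := fun t => deriv f (a + t) - deriv f (b + t))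
      (fun t _ => ?_) (fun t _ => ?_) convex_univ (Set.mem_univ _) (Set.mem_univ _)
    · exact (((hdf _).hasDerivAt.comp_const_add a t).sub
        ((hdf _).hasDerivAt.comp_const_add b t)).hasDerivWithinAt
    · simpa using hlip' (a + t) (b + t)
  have hB := hlip (b + e) (b + e')
  rw [add_sub_add_left_eq_sub] at hB
  rw [sub_zero, add_zero, add_zero] at hA
  have hAB := abs_add_le ((f (a + e) - f (b + e)) - (f a - f b)) (f (b + e) - f (b + e'))
  rw [show (f (a + e) - f (b + e)) - (f a - f b) + (f (b + e) - f (b + e'))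
    = (f (a + e) - f a) - (f (b + e') - f b) by ring] at hAB
  have : 0 ≤ L₁ * (|a - b| * |e|) := by positivity
  have : 0 ≤ L₂ * |e - e'| := by positivity
  linarith

/-- The difference of two Lax–Friedrichs fluxes at perturbed states. -/
theorem abs_laxFriedrichs_sub_le {f : ℝ → ℝ} {L : ℝ} (hL : 0 ≤ L)
    (hf : ∀ a b e e' : ℝ,
      |(f (a + e) - f a) - (f (b + e') - f b)| ≤ L * (|e - e'| + |a - b| * |e|))
    (α : ℝ) {a b e₁ e₂ e₁' e₂' D : ℝ} (hD₁ : |e₁ - e₁'| + |a - b| * |e₁| ≤ D)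
    (hD₂ : |e₂ - e₂'| + |a - b| * |e₂| ≤ D) :
    |laxFriedrichs f α (a + e₁) (a + e₂) - laxFriedrichs f α (b + e₁') (b + e₂') - (f a - f b)|
      ≤ (L + |α|) * D := by
  have h1 := (hf a b e₁ e₁').trans (mul_le_mul_of_nonneg_left hD₁ hL)
  have h2 := (hf a b e₂ e₂').trans (mul_le_mul_of_nonneg_left hD₂ hL)
  have h3 : |α * ((e₂ - e₂') - (e₁ - e₁'))| ≤ |α| * (2 * D) := by
    rw [abs_mul]
    refine mul_le_mul_of_nonneg_left ((abs_sub _ _).trans ?_) (abs_nonneg _)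
    have := mul_nonneg (abs_nonneg (a - b)) (abs_nonneg e₁)
    have := mul_nonneg (abs_nonneg (a - b)) (abs_nonneg e₂)
    linarith
  rw [abs_le] at *
  unfold laxFriedrichs
  constructor <;> linarith [h1.1, h1.2, h2.1, h2.2, h3.1, h3.2]

theorem cellAvg_deriv_eq {g G : ℝ → ℝ} {x₀ η : ℝ} (hG : ContDiff ℝ 1 G)
    (hgG : ∀ y, |y - x₀| < η → g y = G y) {xl h : ℝ} (hh : 0 < h) {j : ℤ}
    (hj : |center xl h j - x₀| + h / 2 < η) :
    cellAvg (deriv g) xl h j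
      = (1 / h) * (g (center xl h j + h / 2) - g (center xl h j - h / 2)) := by
  have hmem : ∀ y ∈ Set.Icc (center xl h j - h / 2) (center xl h j + h / 2), |y - x₀| < η := by
    intro y hy
    have h1 := abs_le.1 (le_refl |center xl h j - x₀|)
    rw [abs_lt]
    constructor <;> linarith [hy.1, hy.2, h1.1, h1.2]
  have heq : ∫ y in (center xl h j - h / 2)..(center xl h j + h / 2), deriv g y
      = ∫ y in (center xl h j - h / 2)..(center xl h j + h / 2), deriv G y := by
    refine intervalIntegral.integral_congr fun y hy => Filter.EventuallyEq.deriv_eq ?_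
    rw [Set.uIcc_of_le (by linarith)] at hy
    have : Metric.ball x₀ η ∈ 𝓝 y := Metric.isOpen_ball.mem_nhds (hmem y hy)
    filter_upwards [this] with z hz using hgG z hz
  rw [cellAvg, heq, intervalIntegral.integral_deriv_eq_sub
    (fun y _ => hG.differentiable (by norm_num) y)
    ((hG.continuous_deriv le_rfl).intervalIntegrable _ _),
    hgG _ (hmem _ ⟨by linarith, le_rfl⟩), hgG _ (hmem _ ⟨le_rfl, by linarith⟩)]

end WENO

end

/-! ### The order of accuracy of the scheme. -/

theorem mainTheorem9 (r : ℕ) [NeZero r] (ncp : ℕ) (hncp : (ncp : ℤ) < (r : ℤ) - 1)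
    (d : Fin r → ℝ) (hd : WENO.IsIdealWeights d)
    (B : ℝ) (k : ℕ) (CFS δ : Fin r → ℝ) (hACM : WENO.ACMAdmissible B k d CFS δ)
    (u f : ℝ → ℝ) (α x₀ : ℝ)
    (hu : ContDiffAt ℝ ∞ u x₀) (hf : ContDiffAt ℝ ∞ f (u x₀))
    (hcrit : WENO.HasCriticalOrder u x₀ ncp) :
    ∃ C > 0, ∃ h₀ > 0, ∃ η > 0, ∀ ε : ℝ, 0 ≤ ε → ∀ xl h : ℝ, 0 < h → h < h₀ →
      ∀ j : ℤ, |WENO.center xl h j - x₀| < η →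
        |WENO.uMinus (WENO.reconMOPACM B k d CFS δ ε) (WENO.cellAvg u xl h) j
            - u (WENO.center xl h j + h / 2)| ≤ C * h ^ (2 * r - 1) ∧
        |WENO.uPlus (WENO.reconMOPACM B k d CFS δ ε) (WENO.cellAvg u xl h) j
            - u (WENO.center xl h j + h / 2)| ≤ C * h ^ (2 * r - 1) ∧
        |WENO.spatialOp (WENO.reconMOPACM B k d CFS δ ε) f α h (WENO.cellAvg u xl h) j
            - (-WENO.cellAvg (deriv (f ∘ u)) xl h j)| ≤ C * h ^ (2 * r - 1) := by
  have hr : 0 < r := Nat.pos_of_neZero r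
  obtain ⟨w, hw, hwc, hwu⟩ := WENO.exists_contDiff_hasCompactSupport_eventuallyEq hu (2 * r)
  obtain ⟨F, hF, hFc, hFf⟩ := WENO.exists_contDiff_hasCompactSupport_eventuallyEq hf 2
  obtain ⟨C, hC0, h₁, hh₁, η₁, hη₁, E, hrecon, hE, hE'⟩ :=
    WENO.exists_reconMOPACM_eq_add (n := ncp + 1) (Finset.mem_Icc.2 (by omega)) hd hACM hw hwc hwu
      hcrit.2
  obtain ⟨L, hL0, hL⟩ := WENO.exists_abs_increment_sub_le (by exact_mod_cast hF) hFc
  have hw1 : ContDiff ℝ 1 w := hw.of_le (by exact_mod_cast (by omega : 1 ≤ 2 * r))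
  obtain ⟨M, hM0, hM⟩ := WENO.exists_abs_iteratedDeriv_le (n := 1) (by exact_mod_cast hw1) hwc
  have hwlip : ∀ a b, |w a - w b| ≤ M * |a - b| := fun a b =>
    Convex.norm_image_sub_le_of_norm_deriv_le (s := Set.univ)
      (fun x _ => hw1.differentiable (by norm_num) x)
      (fun x _ => by rw [← iteratedDeriv_one]; exact hM x) convex_univ (Set.mem_univ _)
      (Set.mem_univ _)
  obtain ⟨η₂, hη₂, hwu'⟩ := Metric.eventually_nhds_iff.1 hwu
  obtain ⟨ρ, hρ, hFf'⟩ := Metric.eventually_nhds_iff.1 hFf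
  obtain ⟨η₃, hη₃, hu'⟩ := Metric.continuousAt_iff.1 hu.continuousAt (ρ / 2) (by positivity)
  simp only [Real.dist_eq] at hwu' hFf' hu'
  have hη : 0 < min η₁ (min η₂ η₃) := by positivity
  set η := min η₁ (min η₂ η₃) with hηdef
  have hη1 : η ≤ η₁ := min_le_left _ _
  have hη2 : η ≤ η₂ := (min_le_right _ _).trans (min_le_left _ _)
  have hη3 : η ≤ η₃ := (min_le_right _ _).trans (min_le_right _ _)
  -- The radius `η / 4` with `h < η / 4` leaves room for the neighbouring cells; the bound by `ρ`
  -- keeps the reconstructed states where `F = f`.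
  refine ⟨C + (L + |α|) * (C + M * C) + 1, by positivity,
    min h₁ (min 1 (min (η / 4) (ρ / (2 * (C + 1))))), by positivity, η / 4, by positivity,
    fun ε hε xl h hh0 hh j hj => ?_⟩
  simp only [lt_min_iff] at hh
  obtain ⟨hhh₁, hh1, hhη, hhρ⟩ := hh
  rw [lt_div_iff₀ (by positivity)] at hhρ
  have habs : |h| = h := abs_of_pos hh0
  have habsn : |-h| = h := by rw [abs_neg, habs]
  set R := WENO.reconMOPACM B k d CFS δ ε
  have hnear : ∀ t : ℝ, |t| ≤ 2 * h → |WENO.center xl h j + t - x₀| < η := fun t ht => by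
    have := abs_add_le (WENO.center xl h j - x₀) t
    rw [show WENO.center xl h j + t - x₀ = WENO.center xl h j - x₀ + t by ring]
    linarith
  have hminus : ∀ i : ℤ, |WENO.center xl h i - x₀| < η →
      WENO.uMinus R (WENO.cellAvg u xl h) i
        = u (WENO.center xl h i + h / 2) + E (WENO.center xl h i) h := fun i hi => by
    have := hrecon ε hε _ h (hi.trans_le hη1) hh0.ne' (by rwa [habs])
    rw [← this, WENO.uMinus]
    exact congrArg R (funext fun l => WENO.cellAvg_add _ _ hh0.ne' _ _)
  have hplus : ∀ i : ℤ, |WENO.center xl h i + h - x₀| < η →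
      WENO.uPlus R (WENO.cellAvg u xl h) i
        = u (WENO.center xl h i + h / 2) + E (WENO.center xl h i + h) (-h) := fun i hi => by
    have := hrecon ε hε _ (-h) (hi.trans_le hη1) (neg_ne_zero.2 hh0.ne') (by rwa [habsn])
    rw [show WENO.center xl h i + h / 2 = WENO.center xl h i + h + -h / 2 by ring, ← this,
      WENO.uPlus]
    exact congrArg R (funext fun l => WENO.cellAvg_add_one_sub _ _ hh0.ne' _ _)
  have hc1 : WENO.center xl h (j - 1) = WENO.center xl h j - h := by
    unfold WENO.center
    push_cast
    ring
  set x := WENO.center xl h j with hx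
  have hpow : 0 ≤ h ^ (2 * r - 1) := by positivity
  have hEm : ∀ y, |E y h| ≤ C * h ^ (2 * r - 1) := fun y => by simpa only [habs] using hE y h
  have hEp : ∀ y, |E y (-h)| ≤ C * h ^ (2 * r - 1) := fun y => by
    simpa only [habsn] using hE y (-h)
  have hEm' : ∀ y, |E y h - E (y - h) h| ≤ C * h * h ^ (2 * r - 1) := fun y => by
    simpa only [habs] using hE' y h h
  have hEp' : ∀ y, |E y (-h) - E (y - h) (-h)| ≤ C * h * h ^ (2 * r - 1) := fun y => by
    simpa only [habs, habsn] using hE' y h (-h)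
  have hCle : C * h ^ (2 * r - 1) ≤ (C + (L + |α|) * (C + M * C) + 1) * h ^ (2 * r - 1) := by
    refine mul_le_mul_of_nonneg_right ?_ hpow
    have : 0 ≤ (L + |α|) * (C + M * C) := by positivity
    linarith
  -- At the two faces the error `E` is taken at `x` and `x - h` for `u^-`, at `x + h` and `x` for
  -- `u^+`: in each pair a shift by `h` at the same signed width.
  have hm0 := hminus j (by simpa using hnear 0 (by simpa using hh0.le))
  have hp0 := hplus j (hnear h (by rw [habs]; linarith))
  have hm1 := hminus (j - 1) (by
    rw [hc1, sub_eq_add_neg]; exact hnear (-h) (by rw [habsn]; linarith))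
  have hp1 := hplus (j - 1) (by
    rw [hc1, sub_add_cancel]; simpa using hnear 0 (by simpa using hh0.le))
  rw [hc1, show x - h + h / 2 = x - h / 2 by ring] at hm1 hp1
  rw [sub_add_cancel] at hp1
  refine ⟨?_, ?_, ?_⟩
  · rw [hm0, add_sub_cancel_left]
    exact (hEm x).trans hCle
  · rw [hp0, add_sub_cancel_left]
    exact (hEp (x + h)).trans hCle
  have hright : |x + h / 2 - x₀| < η := hnear _ (by rw [abs_of_pos (by positivity)]; linarith)
  have hleft : |x - h / 2 - x₀| < η := by
    rw [sub_eq_add_neg x]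
    exact hnear _ (by rw [abs_neg, abs_of_pos (by positivity)]; linarith)
  have hsmall : C * h ^ (2 * r - 1) < ρ / 2 := by
    have h2 : h ^ (2 * r - 1) ≤ h := pow_le_of_le_one hh0.le hh1.le (by omega)
    have h3 := mul_le_mul_of_nonneg_left h2 hC0
    linarith
  have hfF : ∀ y e, |y - x₀| < η → |e| ≤ C * h ^ (2 * r - 1) → f (u y + e) = F (u y + e) := by
    intro y e hy he
    refine (hFf' ?_).symm
    have h2 := hu' (hy.trans_le hη3)
    have h3 := abs_add_le (u y - u x₀) e
    rw [show u y + e - u x₀ = u y - u x₀ + e by ring]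
    linarith
  have hfF0 : ∀ y, |y - x₀| < η → f (u y) = F (u y) := fun y hy => by
    simpa using hfF y 0 hy (by simpa using mul_nonneg hC0 hpow)
  have hab : |u (x + h / 2) - u (x - h / 2)| ≤ M * h := by
    rw [← hwu' (hright.trans_le hη2), ← hwu' (hleft.trans_le hη2)]
    refine (hwlip _ _).trans_eq ?_
    rw [show x + h / 2 - (x - h / 2) = h by ring, habs]
  -- Both terms gain a factor `h`: the first from the Lipschitz bound on `E`, the second from that
  -- on `u`. It cancels the `1 / h` of the operator.
  have hflux : ∀ e₁ e₁', |e₁ - e₁'| ≤ C * h * h ^ (2 * r - 1) → |e₁| ≤ C * h ^ (2 * r - 1) →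
      |e₁ - e₁'| + |u (x + h / 2) - u (x - h / 2)| * |e₁|
        ≤ (C + M * C) * (h * h ^ (2 * r - 1)) := fun e₁ e₁' h2 h3 => by
    have := mul_le_mul hab h3 (abs_nonneg _) (by positivity)
    linarith
  have hLF := WENO.abs_laxFriedrichs_sub_le hL0 hL α
    (hflux _ _ (hEm' x) (hEm x))
    (hflux _ _ (by simpa only [add_sub_cancel_right] using hEp' (x + h)) (hEp (x + h)))
  have havg := WENO.cellAvg_deriv_eq (g := f ∘ u) (G := F ∘ w) (x₀ := x₀) (η := η)
    ((hF.of_le (by norm_num)).comp hw1)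
    (fun y hy => by
      rw [Function.comp_apply, Function.comp_apply, hwu' (hy.trans_le hη2), hfF0 y hy])
    hh0 (xl := xl) (j := j) (by linarith)
  rw [havg, ← hx, WENO.spatialOp, WENO.numFlux, WENO.numFlux, hm0, hp0, hm1, hp1]
  have hLFeq : ∀ y e e', |y - x₀| < η → |e| ≤ C * h ^ (2 * r - 1) →
      |e'| ≤ C * h ^ (2 * r - 1) →
      WENO.laxFriedrichs f α (u y + e) (u y + e') = WENO.laxFriedrichs F α (u y + e) (u y + e') :=
    fun y e e' hy h2 h3 => by
      rw [WENO.laxFriedrichs, WENO.laxFriedrichs, hfF y e hy h2, hfF y e' hy h3]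
  rw [hLFeq _ _ _ hright (hEm _) (hEp _), hLFeq _ _ _ hleft (hEm _) (hEp _),
    Function.comp_apply, Function.comp_apply, hfF0 _ hright, hfF0 _ hleft]
  rw [show ∀ a b c d : ℝ, -(1 / h) * (a - b) - -(1 / h * (c - d)) = -((a - b - (c - d)) / h) from
    fun a b c d => by ring, abs_neg, abs_div, habs, div_le_iff₀ hh0]
  refine hLF.trans ?_
  have : 0 ≤ (C + 1) * (h * h ^ (2 * r - 1)) := by positivity
  linarith
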